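/- **Theorem (the queue implementation is linearizable).** Let $p\ge 2$ and let $p$ asynchronous processes perform enqueues and dequeues on a shared FIFO queue (initially empty) by means of the *ordering-tree* implementation described below. In every finite execution (any schedule of atomic reads, writes and CAS steps; each process invokes its operations one after the other; processes may stop at any time) no process ever dereferences $\mathsf{null}$, and the history of invocations and responses is linearizable. More precisely, let $B_0,\dots,B_n$ be the non-null entries of the root's blocks array at the end of the execution (these occupy exactly the indices $0,\dots,n$), and let $E(B)$, $D(B)$ be the sequences of enqueues and dequeues represented by a block $B$. Then $$L=E(B_1)\cdot D(B_1)\cdot E(B_2)\cdot D(B_2)\cdots E(B_n)\cdot D(B_n)$$ is a linearization of the history: no operation occurs twice in $L$; $L$ consists of operations invoked in the execution and contains every operation that has terminated; if $op_1$ terminates before $op_2$ begins then $op_2$ does not precede $op_1$ in $L$; and every operation that has terminated (in particular every dequeue) returned the response it has when the operations are performed sequentially in the order $L$ on an initially empty queue (a dequeue on an empty queue returns $\mathsf{null}$). **The implementation.** A static binary tree has exactly one leaf per process, and every internal node has a left and a right child (the shape is arbitrary; in particular the height may be $\lceil\log_2 p\rceil$). Each node $v$ has an integer $v.head$, initially $1$,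 and an infinite array $v.blocks[0..\infty]$, initially $\mathsf{null}$ except that $blocks[0]$ is an empty block, whose integer fields are $0$. A block has fields $sum_{enq},sum_{deq}$; $super$ (initially $\mathsf{null}$); $end_{left},end_{right}$ (used in internal nodes); $element$ (used in leaves); $size$ (used in the root). All fields but $super$ are immutable. Every access to $head$, to an entry of $blocks$ or to $super$ is a separate atomic step. * $Enqueue(x)$: with $leaf$ the process's own leaf and $B'=leaf.blocks[leaf.head-1]$, create a block with $element=x$, $sum_{enq}=B'.sum_{enq}+1$, $sum_{deq}=B'.sum_{deq}$, and call $Append$ on it. * $Dequeue()$: create a block with $element=\mathsf{null}$, $sum_{enq}=B'.sum_{enq}$, $sum_{deq}=B'.sum_{deq}+1$ and call $Append$ on it; then let $\langle b,i\rangle:=IndexDequeue(leaf,leaf.head-1,1)$ and return $FindResponse(b,i)$. * $Append(B)$: $h:=leaf.head$; $leaf.blocks[h]:=B$; $Advance(leaf,h)$; $Propagate(leaf.parent)$. * $Propagate(v)$: call $Refresh(v)$; if it returns false, call $Refresh(v)$ once more; if $v$ is not the root, $Propagate(v.parent)$. * $Refresh(v)$: $h:=v.head$; for each child $c$ (left,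 then right): $k:=c.head$, and if $c.blocks[k]\ne\mathsf{null}$ then $Advance(c,k)$; $new:=CreateBlock(v,h)$; if $new=\mathsf{null}$ return true; otherwise $r:=CAS(v.blocks[h],\mathsf{null},new)$, $Advance(v,h)$, return $r$. * $CreateBlock(v,i)$: $new.end_{left}:=v.left.head-1$; $new.end_{right}:=v.right.head-1$; for $x\in\{enq,deq\}$: $new.sum_x:=v.left.blocks[new.end_{left}].sum_x+v.right.blocks[new.end_{right}].sum_x$ and $num_x:=new.sum_x-v.blocks[i-1].sum_x$; if $v$ is the root, $new.size:=\max(0,v.blocks[i-1].size+num_{enq}-num_{deq})$; return $\mathsf{null}$ if $num_{enq}+num_{deq}=0$, and $new$ otherwise. * $Advance(v,h)$: if $v$ is not the root, $h_p:=v.parent.head$ and $CAS(v.blocks[h].super,\mathsf{null},h_p)$; then $CAS(v.head,h,h+1)$. * $IndexDequeue(v,b,i)$: if $v$ is the root return $\langle b,i\rangle$. Let $dir$ be the side on which $v$ is a child of $u=v.parent$. $s:=v.blocks[b].super$; if $b>u.blocks[s].end_{dir}$ then $s:=s+1$. Add $v.blocks[b-1].sum_{deq}-v.blocks[u.blocks[s-1].end_{dir}].sum_{deq}$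 to $i$; if $dir=right$, also add $u.left.blocks[u.blocks[s].end_{left}].sum_{deq}-u.left.blocks[u.blocks[s-1].end_{left}].sum_{deq}$. Return $IndexDequeue(u,s,i)$. * $FindResponse(b,i)$, with $R=root.blocks$: if $R[b-1].size+R[b].sum_{enq}-R[b-1].sum_{enq}<i$ return $\mathsf{null}$. Otherwise $e:=i+R[b-1].sum_{enq}-R[b-1].size$; find (by doubling search from $b$ and binary search) the minimum $b_e\le b$ with $R[b_e].sum_{enq}\ge e$; return $GetEnqueue(root,b_e,e-R[b_e-1].sum_{enq})$. * $GetEnqueue(v,b,i)$: if $v$ is a leaf return $v.blocks[b].element$. Otherwise, for each side $d$ let $prev_d:=v.d.blocks[v.blocks[b-1].end_d].sum_{enq}$, and let $sum_{left}:=v.left.blocks[v.blocks[b].end_{left}].sum_{enq}$. If $i\le sum_{left}-prev_{left}$ let $d=left$; otherwise let $d=right$ and subtract $sum_{left}-prev_{left}$ from $i$. Find by binary search the minimum $b'$ in $[v.blocks[b-1].end_d+1\,..\,v.blocks[b].end_d]$ with $v.d.blocks[b'].sum_{enq}\ge i+prev_d$; return $GetEnqueue(v.d,b',i-(v.d.blocks[b'-1].sum_{enq}-prev_d))$.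 **The sequences $E(B)$, $D(B)$.** In a leaf, $blocks[j]$ ($j\ge1$) represents the $j$th operation of the leaf's process: if it is an enqueue, $E$ is that operation and $D$ is empty; if it is a dequeue, $D$ is that operation and $E$ is empty. For a block $B=v.blocks[b]$, $b\ge 1$, of an internal node $v$, the direct subblocks are $v.left.blocks[j]$ with $v.blocks[b-1].end_{left}<j\le B.end_{left}$ and $v.right.blocks[j]$ with $v.blocks[b-1].end_{right}<j\le B.end_{right}$; $E(B)$ is the concatenation of the $E$-sequences of the left subblocks, in order of index, followed by those of the right subblocks, and $D(B)$ is defined likewise. -/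

import Mathlib

namespace OrderingQueue

/-! ### The ordering tree -/

/-- A node of a binary tree is named by the path that leads from it up to the root, nearest step
first; `false` means left and `true` means right.  So `[]` is the root, the children of `v` are
`false :: v` and `true :: v`, and the parent of `d :: v` is `v`. -/
abbrev Addr : Type := List Bool

/-- Binary trees in which every internal node has a left and a right child and
every leaf carries a label. -/
inductive LTree (P : Type) : Type
  | leaf (k : P) : LTree P
  | node (l r : LTree P) : LTree P

/-- The leaves of a (sub)tree whose root is named `v`, with their labels. -/
def LTree.leavesFrom {P : Type} : LTree P → Addr → List (Addr × P)
  | .leaf k, v => [(v, k)]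
  | .node l r, v => l.leavesFrom (false :: v) ++ r.leavesFrom (true :: v)

/-- A static binary tree with exactly one leaf for each of `p` processes. -/
structure OrderingTree (p : ℕ) where
  shape : LTree (Fin p)
  /-- the leaf of each process -/
  leaf : Fin p → Addr
  leaf_spec : ∀ v k, (v, k) ∈ shape.leavesFrom [] ↔ leaf k = v

/-! ### Shared memory -/

/-- The immutable fields of a block.  `endLeft`, `endRight` are used in internal nodes, `element` in
leaves, `size` in the root; elsewhere they keep their defaults.  `none` is null. -/
structure Block (α : Type) where
  sumEnq : ℤ := 0
  sumDeq : ℤ := 0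
  endLeft : ℕ := 0
  endRight : ℕ := 0
  element : Option α := none
  size : ℤ := 0

/-- The field `endLeft` or `endRight`, according to the direction. -/
def Block.endDir {α : Type} (B : Block α) : Bool → ℕ
  | false => B.endLeft
  | true => B.endRight

/-- The shared memory.  `super v i` is the field `super` of the block stored in `v.blocks[i]`; it is
the only mutable field of a block, and is therefore kept apart from the others. -/
structure Mem (α : Type) where
  head : Addr → ℕ
  blocks : Addr → ℕ → Option (Block α)
  super : Addr → ℕ → Option ℕ

/-- Initially `head` is 1, and `blocks[0]` is the only non-null block, an empty one. -/
def Mem.init (α : Type) : Mem α where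
  head _ := 1
  blocks _ i := if i = 0 then some {} else none
  super _ _ := none

/-! ### Programs: sequences of atomic accesses to the shared memory -/

/-- A program that accesses the shared memory atomically, one access at a time, and returns a value
of type `R`.  `crash` is the outcome of dereferencing null. -/
inductive Prog (α R : Type) : Type
  | ret (r : R) : Prog α R
  | crash : Prog α R
  | readHead (v : Addr) (k : ℕ → Prog α R) : Prog α R
  | readBlock (v : Addr) (i : ℕ) (k : Option (Block α) → Prog α R) : Prog α R
  | readSuper (v : Addr) (i : ℕ) (k : Option ℕ → Prog α R) : Prog α R
  /-- `v.blocks[i] := B` -/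
  | writeBlock (v : Addr) (i : ℕ) (B : Block α) (k : Prog α R) : Prog α R
  /-- `CAS(v.blocks[i], null, B)` -/
  | casBlock (v : Addr) (i : ℕ) (B : Block α) (k : Bool → Prog α R) : Prog α R
  /-- `CAS(v.blocks[i].super, null, s)` -/
  | casSuper (v : Addr) (i : ℕ) (s : ℕ) (k : Prog α R) : Prog α R
  /-- `CAS(v.head, h, h + 1)` -/
  | casHead (v : Addr) (h : ℕ) (k : Prog α R) : Prog α R

namespace Prog

variable {α R S : Type}

/-- Sequential composition. -/
def bind : Prog α R → (R → Prog α S) → Prog α S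
  | ret r, f => f r
  | crash, _ => crash
  | readHead v k, f => readHead v fun x => (k x).bind f
  | readBlock v i k, f => readBlock v i fun x => (k x).bind f
  | readSuper v i k, f => readSuper v i fun x => (k x).bind f
  | writeBlock v i B k, f => writeBlock v i B (k.bind f)
  | casBlock v i B k, f => casBlock v i B fun x => (k x).bind f
  | casSuper v i s k, f => casSuper v i s (k.bind f)
  | casHead v h k, f => casHead v h (k.bind f)

instance : Monad (Prog α) where
  pure := ret
  bind := bind

/-- One atomic step of a program; `none` if there is no further step to take. -/
def step (m : Mem α) : Prog α R → Option (Mem α × Prog α R)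
  | ret _ => none
  | crash => none
  | readHead v k => some (m, k (m.head v))
  | readBlock v i k => some (m, k (m.blocks v i))
  | readSuper v i k =>
      match m.blocks v i with
      | none => some (m, crash)
      | some _ => some (m, k (m.super v i))
  | writeBlock v i B k =>
      some ({ m with blocks := Function.update m.blocks v
                      (Function.update (m.blocks v) i (some B)) }, k)
  | casBlock v i B k =>
      match m.blocks v i with
      | none => some ({ m with blocks := Function.update m.blocks v
                                (Function.update (m.blocks v) i (some B)) }, k true)
      | some _ => some (m, k false)
  | casSuper v i s k =>
      match m.blocks v i, m.super v i with
      | none, _ => some (m, crash)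
      | some _, none => some ({ m with super := Function.update m.super v
                                        (Function.update (m.super v) i (some s)) }, k)
      | some _, some _ => some (m, k)
  | casHead v h k =>
      if m.head v = h then some ({ m with head := Function.update m.head v (h + 1) }, k)
      else some (m, k)

end Prog

/-! ### The queue implementation -/

section Implementation

variable {α : Type}

/-- Read `v.head`. -/
def getHead (v : Addr) : Prog α ℕ := .readHead v .ret

/-- Read `v.blocks[i]`, which may be null. -/
def getBlock? (v : Addr) (i : ℕ) : Prog α (Option (Block α)) := .readBlock v i .ret

/-- Read `v.blocks[i]` in order to access a field of it. -/
def getBlock (v : Addr) (i : ℕ) : Prog α (Block α) :=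
  .readBlock v i fun
    | some B => .ret B
    | none => .crash

/-- Read `v.blocks[i].super` in order to use it as an index. -/
def getSuper (v : Addr) (i : ℕ) : Prog α ℕ :=
  .readSuper v i fun
    | some s => .ret s
    | none => .crash

def setBlock (v : Addr) (i : ℕ) (B : Block α) : Prog α Unit := .writeBlock v i B (.ret ())

def tryBlock (v : Addr) (i : ℕ) (B : Block α) : Prog α Bool := .casBlock v i B .ret

def trySuper (v : Addr) (i s : ℕ) : Prog α Unit := .casSuper v i s (.ret ())

def tryHead (v : Addr) (h : ℕ) : Prog α Unit := .casHead v h (.ret ())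

/-- Set `v.blocks[h].super` and increment `v.head` from `h` to `h + 1`. -/
def advance (v : Addr) (h : ℕ) : Prog α Unit := do
  match v with
  | [] => pure ()
  | _ :: parent =>
    let hp ← getHead parent
    trySuper v h hp
  tryHead v h

/-- Create a new block for a refresh to install in `v.blocks[i]`; `none` if there is nothing to
propagate. -/
def createBlock (v : Addr) (i : ℕ) : Prog α (Option (Block α)) := do
  let endLeft := (← getHead (false :: v)) - 1
  let endRight := (← getHead (true :: v)) - 1
  let sumEnq := (← getBlock (false :: v) endLeft).sumEnq
    + (← getBlock (true :: v) endRight).sumEnq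
  let sumDeq := (← getBlock (false :: v) endLeft).sumDeq
    + (← getBlock (true :: v) endRight).sumDeq
  let numEnq := sumEnq - (← getBlock v (i - 1)).sumEnq
  let numDeq := sumDeq - (← getBlock v (i - 1)).sumDeq
  let size ←
    if v = [] then do
      let B ← getBlock v (i - 1)
      pure (max 0 (B.size + numEnq - numDeq))
    else pure 0
  if numEnq + numDeq = 0 then pure none
  else pure (some
    { sumEnq := sumEnq, sumDeq := sumDeq, endLeft := endLeft, endRight := endRight, size := size })

/-- Help to advance the head of the node `c` if its last block has been installed already. -/
def helpAdvance (c : Addr) : Prog α Unit := do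
  let childHead ← getHead c
  match ← getBlock? c childHead with
  | some _ => advance c childHead
  | none => pure ()

/-- Try to append a new block to `v.blocks`. -/
def refresh (v : Addr) : Prog α Bool := do
  let h ← getHead v
  helpAdvance (false :: v)
  helpAdvance (true :: v)
  match ← createBlock v h with
  | none => pure true
  | some new =>
    let result ← tryBlock v h new
    advance v h
    pure result

/-- Propagate blocks from the children of `v` to the root. -/
def propagate : Addr → Prog α Unit
  | [] => do
    if !(← refresh []) then
      let _ ← refresh []
    pure ()
  | d :: parent => do
    if !(← refresh (d :: parent)) then
      let _ ← refresh (d :: parent)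
    propagate parent

/-- Append the block `B` to the given leaf and propagate it to the root. -/
def append (leaf : Addr) (B : Block α) : Prog α Unit := do
  let h ← getHead leaf
  setBlock leaf h B
  advance leaf h
  match leaf with
  | [] => .crash
  | _ :: parent => propagate parent

/-- The location in the root, as the index of a block and a rank within the dequeues of that block,
of the `i`th dequeue of `v.blocks[b]`. -/
def indexDequeue : Addr → ℕ → ℤ → Prog α (ℕ × ℤ)
  | [], b, i => pure (b, i)
  | dir :: parent, b, i => do
    let sup ← getSuper (dir :: parent) b
    let sup := if b > (← getBlock parent sup).endDir dir then sup + 1 else sup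
    let before ← getBlock (dir :: parent) (b - 1)
    let prev ← getBlock parent (sup - 1)
    let first ← getBlock (dir :: parent) (prev.endDir dir)
    let i := i + (before.sumDeq - first.sumDeq)
    if dir = true then
      let cur ← getBlock parent sup
      let lastL ← getBlock (false :: parent) cur.endLeft
      let prev ← getBlock parent (sup - 1)
      let prevL ← getBlock (false :: parent) prev.endLeft
      indexDequeue parent sup (i + (lastL.sumDeq - prevL.sumDeq))
    else
      indexDequeue parent sup i

/-- Binary search for the minimum `b` in `lo..hi` with `v.blocks[b].sumEnq ≥ e`. -/
def binarySearch (v : Addr) (e : ℤ) (lo hi : ℕ) : Prog α ℕ :=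
  if _h : lo < hi then do
    let B ← getBlock v ((lo + hi) / 2)
    if B.sumEnq ≥ e then binarySearch v e lo ((lo + hi) / 2)
    else binarySearch v e ((lo + hi) / 2 + 1) hi
  else pure lo
termination_by hi - lo

/-- Doubling search for the left end of the range for the binary search in the root: compare `e` to
the `sumEnq` fields at indices `b - 2 ^ j`, `b - 2 ^ (j + 1)`, .... -/
def doublingSearch (e : ℤ) (b j : ℕ) : Prog α ℕ :=
  if _h : 2 ^ j < b then do
    let B ← getBlock [] (b - 2 ^ j)
    if B.sumEnq < e then pure (b - 2 ^ j + 1)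
    else doublingSearch e b (j + 1)
  else pure 1
termination_by b - 2 ^ j
decreasing_by
  have h1 : 0 < 2 ^ j := Nat.two_pow_pos j
  rw [pow_succ]
  omega

/-- The argument of the `i`th enqueue of `v.blocks[b]`, where `t` is the subtree rooted at `v`. -/
def getEnqueue {P : Type} : LTree P → Addr → ℕ → ℤ → Prog α (Option α)
  | .leaf _, v, b, _ => do
    pure (← getBlock v b).element
  | .node l r, v, b, i => do
    let sumLeft := (← getBlock (false :: v) (← getBlock v b).endLeft).sumEnq
    let prevLeft := (← getBlock (false :: v) (← getBlock v (b - 1)).endLeft).sumEnq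
    let prevRight := (← getBlock (true :: v) (← getBlock v (b - 1)).endRight).sumEnq
    if i ≤ sumLeft - prevLeft then
      let lo := (← getBlock v (b - 1)).endLeft + 1
      let hi := (← getBlock v b).endLeft
      let b' ← binarySearch (false :: v) (i + prevLeft) lo hi
      let i' := i - ((← getBlock (false :: v) (b' - 1)).sumEnq - prevLeft)
      getEnqueue l (false :: v) b' i'
    else
      let i := i - (sumLeft - prevLeft)
      let lo := (← getBlock v (b - 1)).endRight + 1
      let hi := (← getBlock v b).endRight
      let b' ← binarySearch (true :: v) (i + prevRight) lo hi
      let i' := i - ((← getBlock (true :: v) (b' - 1)).sumEnq - prevRight)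
      getEnqueue r (true :: v) b' i'

/-- The response to the `i`th dequeue of the `b`th block of the root of the tree `t`. -/
def findResponse {P : Type} (t : LTree P) (b : ℕ) (i : ℤ) : Prog α (Option α) := do
  let numEnq := (← getBlock [] b).sumEnq - (← getBlock [] (b - 1)).sumEnq
  if (← getBlock [] (b - 1)).size + numEnq < i then pure none
  else
    let e := i + (← getBlock [] (b - 1)).sumEnq - (← getBlock [] (b - 1)).size
    let lo ← doublingSearch e b 0
    let be ← binarySearch [] e lo b
    let ie := e - (← getBlock [] (be - 1)).sumEnq
    getEnqueue t [] be ie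

/-- Enqueue, called by the owner of the given leaf. -/
def enqueue (leaf : Addr) (x : α) : Prog α Unit := do
  let sumEnq := (← getBlock leaf ((← getHead leaf) - 1)).sumEnq + 1
  let sumDeq := (← getBlock leaf ((← getHead leaf) - 1)).sumDeq
  append leaf { element := some x, sumEnq := sumEnq, sumDeq := sumDeq }

/-- Dequeue, called by the owner of the given leaf; the response `none` (null) means that the queue
is empty. -/
def dequeue {P : Type} (t : LTree P) (leaf : Addr) : Prog α (Option α) := do
  let sumEnq := (← getBlock leaf ((← getHead leaf) - 1)).sumEnq
  let sumDeq := (← getBlock leaf ((← getHead leaf) - 1)).sumDeq + 1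
  append leaf { element := none, sumEnq := sumEnq, sumDeq := sumDeq }
  let (b, i) ← indexDequeue leaf ((← getHead leaf) - 1) 1
  findResponse t b i

end Implementation

/-! ### Executions and histories -/

/-- The operations on the queue. -/
inductive Op (α : Type) : Type
  | enq (x : α) : Op α
  | deq : Op α

/-- The responses: an acknowledgement of an enqueue, or the value (possibly null) that a dequeue
returns. -/
inductive Resp (α : Type) : Type
  | ack : Resp α
  | value (r : Option α) : Resp α

/-- Invocations and responses of operations by `p` processes. -/
inductive Event (p : ℕ) (α : Type) : Type
  | inv (k : Fin p) (o : Op α) : Event p α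
  | res (k : Fin p) (r : Resp α) : Event p α

/-- The program that process `k` runs to perform an operation. -/
def OrderingTree.program {p : ℕ} {α : Type} (T : OrderingTree p) (k : Fin p) :
    Op α → Prog α (Resp α)
  | .enq x => do
    enqueue (T.leaf k) x
    pure .ack
  | .deq => do
    pure (.value (← dequeue T.shape (T.leaf k)))

/-- A configuration: the shared memory and, for each process, the rest of the program of its pending
operation (`none` if it has no pending operation). -/
structure Config (p : ℕ) (α : Type) where
  mem : Mem α
  proc : Fin p → Option (Prog α (Resp α))

/-- `Execution T H c`: some finite execution of the implementation, in which the processes are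
scheduled arbitrarily and invoke arbitrary operations one after the other, has history `H` and ends
in configuration `c`. -/
inductive Execution {p : ℕ} {α : Type} (T : OrderingTree p) : List (Event p α) → Config p α → Prop
  | init : Execution T [] ⟨Mem.init α, fun _ => none⟩
  | invoke {H : List (Event p α)} {c : Config p α} (k : Fin p) (o : Op α) :
      Execution T H c → c.proc k = none →
      Execution T (H ++ [.inv k o]) ⟨c.mem, Function.update c.proc k (some (T.program k o))⟩
  | step {H : List (Event p α)} {c : Config p α} (k : Fin p) {P P' : Prog α (Resp α)}
      {m : Mem α} :
      Execution T H c → c.proc k = some P → P.step c.mem = some (m, P') →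
      Execution T H ⟨m, Function.update c.proc k (some P')⟩
  | respond {H : List (Event p α)} {c : Config p α} (k : Fin p) (r : Resp α) :
      Execution T H c → c.proc k = some (.ret r) →
      Execution T (H ++ [.res k r]) ⟨c.mem, Function.update c.proc k none⟩

/-! ### Linearizability -/

section Linearizability

variable {p : ℕ} {α : Type}

/-- `(k, n)` stands for the operation of process `k` that comes after `n` other operations
of `k`. -/
abbrev OpId (p : ℕ) : Type := Fin p × ℕ

/-- The operations that process `k` invokes in a history. -/
def invocations (H : List (Event p α)) (k : Fin p) : List (Op α) :=
  H.filterMap fun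
    | .inv j o => if j = k then some o else none
    | .res _ _ => none

/-- The responses that process `k` receives in a history. -/
def responses (H : List (Event p α)) (k : Fin p) : List (Resp α) :=
  H.filterMap fun
    | .inv _ _ => none
    | .res j r => if j = k then some r else none

/-- The operation with the given name, if it is invoked in the history. -/
def invocation (H : List (Event p α)) (a : OpId p) : Option (Op α) := (invocations H a.1)[a.2]?

/-- The response to the operation with the given name, if it terminates in the history. -/
def response (H : List (Event p α)) (a : OpId p) : Option (Resp α) := (responses H a.1)[a.2]?

/-- The operation `a` terminates before the operation `b` begins. -/
def Precedes (H : List (Event p α)) (a b : OpId p) : Prop :=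
  ∃ H₁ H₂, H = H₁ ++ H₂ ∧ response H₁ a ≠ none ∧ invocation H₁ b = none

/-- The responses of a sequential FIFO queue, initially containing `q` (front first), to a sequence
of operations. -/
def seqResponses : List α → List (Op α) → List (Resp α)
  | _, [] => []
  | q, .enq x :: os => .ack :: seqResponses (q ++ [x]) os
  | [], .deq :: os => .value none :: seqResponses [] os
  | x :: q, .deq :: os => .value (some x) :: seqResponses q os

/-- `L` is a linearization of the history `H`. -/
structure IsLinearization (H : List (Event p α)) (L : List (OpId p)) : Prop where
  /-- no operation appears twice -/
  nodup : L.Nodup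
  /-- only operations of the history appear -/
  invoked : ∀ a ∈ L, invocation H a ≠ none
  /-- all operations that terminate appear -/
  complete : ∀ a, response H a ≠ none → a ∈ L
  /-- if `b` terminates before `a` begins then `a` does not come before `b` -/
  realTime : L.Pairwise fun a b => ¬ Precedes H b a
  /-- each operation that terminates returns the response it would return if the operations were
  performed sequentially in the order `L`, on an initially empty queue -/
  legal : ∀ (i : ℕ) (a : OpId p) (r : Resp α), L[i]? = some a → response H a = some r →
    (seqResponses [] (L.filterMap (invocation H)))[i]? = some r

/-- A history is linearizable if it has a linearization. -/
def Linearizable (H : List (Event p α)) : Prop := ∃ L, IsLinearization H L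

/-! ### The operations contained in a block, and the linearization ordering -/

/-- The field `endLeft` or `endRight` of `v.blocks[b]`. -/
def Mem.endOf (m : Mem α) (v : Addr) (b : ℕ) (dir : Bool) : ℕ :=
  match m.blocks v b with
  | some B => B.endDir dir
  | none => 0

/-- The indices of the direct subblocks of `v.blocks[b]` in the child of `v` in direction `dir`. -/
def Mem.subblocks (m : Mem α) (v : Addr) (b : ℕ) (dir : Bool) : List ℕ :=
  List.Ico (m.endOf v (b - 1) dir + 1) (m.endOf v b dir + 1)

/-- The sequence of those operations represented by `v.blocks[b]` whose leaf block satisfies `sel`,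
where the given tree is the subtree rooted at `v`.  A block in a leaf represents one operation of
the leaf's process: `blocks[1]`, `blocks[2]`, ... represent its successive operations, and
`blocks[0]` represents none. -/
def Mem.opSeq (m : Mem α) (sel : Block α → Bool) : LTree (Fin p) → Addr → ℕ → List (OpId p)
  | .leaf _, _, 0 => []
  | .leaf k, v, n + 1 =>
      match m.blocks v (n + 1) with
      | some B => if sel B then [(k, n)] else []
      | none => []
  | .node l r, v, b =>
      (m.subblocks v b false).flatMap (m.opSeq sel l (false :: v)) ++
      (m.subblocks v b true).flatMap (m.opSeq sel r (true :: v))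

/-- The enqueue sequence of `root.blocks[b]`. -/
def OrderingTree.rootEnqs (T : OrderingTree p) (m : Mem α) (b : ℕ) : List (OpId p) :=
  m.opSeq (fun B => B.element.isSome) T.shape [] b

/-- The dequeue sequence of `root.blocks[b]`. -/
def OrderingTree.rootDeqs (T : OrderingTree p) (m : Mem α) (b : ℕ) : List (OpId p) :=
  m.opSeq (fun B => B.element.isNone) T.shape [] b

/-- The linearization ordering when the blocks of the root are `root.blocks[0..n]`: block by block,
the enqueues of each block before its dequeues. -/
def OrderingTree.linearization (T : OrderingTree p) (m : Mem α) (n : ℕ) : List (OpId p) :=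
  (List.Ico 1 (n + 1)).flatMap fun b => T.rootEnqs m b ++ T.rootDeqs m b

end Linearizability

end OrderingQueue

open OrderingQueue

namespace OrderingQueue

/-! Every operation is a block in a leaf, and it enters the linearization once a block of the root
represents it. Installed blocks never change, and the array of the root grows only at its end, so
the list read off the root grows only by appending (`Le.lin_prefix`). At every moment it contains
all terminated operations and only invoked ones. Real-time order follows: if one operation ends
before another begins, the list of that moment is a prefix that contains the first and not the
second.

A terminated operation is in the list because two refreshes suffice at each node. A refresh that
returns true leaves all blocks that the children had at its start covered by a block of the node. If
both fail, the head of the node has moved twice, so one of the blocks installed comes from a refresh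
that read the head after the first of the two began. That refresh brought the heads of the children
up to date before it read them, so its block covers everything too. To state this as an invariant of
the memory, the auxiliary field `snap` records how far the children had got when the head took each
value. A block reaches at least as far as the snapshot for its index (`snap_le`,
`absorbed_of_head_lt`).

The responses are right because the sums in the blocks are prefix counts of operations
(`Counts.length_seg`), so that a rank in a block turns into a rank in the parent's block, upwards
for dequeues and downwards for enqueues. The field `super` may be one too small, but no worse
(`super_spec`), and one comparison corrects it. In the root, `size` is the length of the queue,
whose contents are always a suffix of all values enqueued so far (`Inv.queueAfter_linearization`);
this determines the rank of the enqueue that a dequeue has to return (`Inv.answer_deq`).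

Concurrency is treated by rely-guarantee reasoning. The predicate `wp` allows arbitrary interference
before each access, restricted only by `Rely`: the world evolves monotonically (`Le`), satisfies
`Inv`, and the process's own leaf array and list of operations stay fixed. The guarantee of one
process implies the rely of the others, so `wp_step` and `wp_rely` carry the invariant `Good`
through every execution. -/

/-! ### Subtrees -/

/-- `t` is the subtree of `s` whose root is named `v`. -/
inductive LTree.At {P : Type} (s : LTree P) : Addr → LTree P → Prop
  | root : LTree.At s [] s
  | left {v : Addr} {l r : LTree P} : LTree.At s v (.node l r) → LTree.At s (false :: v) l
  | right {v : Addr} {l r : LTree P} : LTree.At s v (.node l r) → LTree.At s (true :: v) r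

section Trees

variable {P : Type} {s : LTree P}

theorem LTree.At.unique {v : Addr} {t t' : LTree P} (h : s.At v t) (h' : s.At v t') : t = t' := by
  induction h generalizing t' with
  | root => cases h'; rfl
  | left _ ih =>
    cases h' with
    | left h2 => have := ih h2; simp_all
  | right _ ih =>
    cases h' with
    | right h2 => have := ih h2; simp_all

theorem LTree.At.parent {d : Bool} {u : Addr} {t : LTree P} (h : s.At (d :: u) t) :
    ∃ l r, s.At u (.node l r) ∧ t = if d then r else l := by
  cases h with
  | left h => exact ⟨_, _, h, by simp⟩
  | right h => exact ⟨_, _, h, by simp⟩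

theorem LTree.At.mem_leavesFrom {t : LTree P} {u v : Addr} {k : P} (hu : s.At u t)
    (h : (v, k) ∈ t.leavesFrom u) : s.At v (.leaf k) := by
  induction t generalizing u with
  | leaf j =>
    simp only [LTree.leavesFrom, List.mem_singleton, Prod.mk.injEq] at h
    rw [h.1, h.2]; exact hu
  | node l r ihl ihr =>
    simp only [LTree.leavesFrom, List.mem_append] at h
    rcases h with h | h
    · exact ihl hu.left h
    · exact ihr hu.right h

theorem LTree.At.leavesFrom_subset {t : LTree P} {u : Addr} (hu : s.At u t) :
    t.leavesFrom u ⊆ s.leavesFrom [] := by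
  induction hu with
  | root => exact fun _ h => h
  | left _ ih => exact fun x h => ih (by simp [LTree.leavesFrom, h])
  | right _ ih => exact fun x h => ih (by simp [LTree.leavesFrom, h])

variable {p : ℕ} (T : OrderingTree p)

theorem OrderingTree.at_leaf_iff {v : Addr} {k : Fin p} :
    T.shape.At v (.leaf k) ↔ T.leaf k = v := by
  rw [← T.leaf_spec]
  exact ⟨fun h => h.leavesFrom_subset (by simp [LTree.leavesFrom]),
    fun h => LTree.At.root.mem_leavesFrom h⟩

/-- The address `v` is that of a leaf. -/
def OrderingTree.IsLeaf (v : Addr) : Prop := ∃ k, T.leaf k = v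

theorem OrderingTree.not_isLeaf {v : Addr} {l r : LTree (Fin p)} (h : T.shape.At v (.node l r)) :
    ¬ T.IsLeaf v := by
  rintro ⟨k, hk⟩
  exact LTree.noConfusion rfl (heq_of_eq ((T.at_leaf_iff.2 hk).unique h))

theorem OrderingTree.leaf_injective {j k : Fin p} (h : T.leaf j = T.leaf k) : j = k := by
  have := (T.at_leaf_iff.2 h).unique (T.at_leaf_iff.2 rfl)
  simpa using this

/-- A leaf at the root would be the only leaf and leave room for one process only. So `append`
always finds a parent to propagate to. -/
theorem OrderingTree.leaf_ne_nil (hp : 2 ≤ p) (k : Fin p) : T.leaf k ≠ [] := by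
  intro h
  have h0 : T.shape = .leaf k := LTree.At.root.unique (T.at_leaf_iff.2 h)
  have key : ∀ j, j = k := fun j => by
    have h1 := (T.leaf_spec (T.leaf j) j).2 rfl
    rw [h0] at h1
    simp only [LTree.leavesFrom, List.mem_singleton, Prod.mk.injEq] at h1
    exact h1.2
  have := (key ⟨0, by omega⟩).trans (key ⟨1, by omega⟩).symm
  simp at this

end Trees

/-! ### Worlds: the shared memory with auxiliary information -/

/-- The shared memory, together with the index `snap u h d` of the last block that the child `d :: u`
had when `u.head` became `h`, and the operations that each process has invoked. -/
structure World (p : ℕ) (α : Type) extends Mem α where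
  snap : Addr → ℕ → Bool → ℕ
  ops : Fin p → List (Op α)

/-- The memory after `v.blocks[i] := B`. -/
def Mem.setBlock {α : Type} (m : Mem α) (v : Addr) (i : ℕ) (B : Block α) : Mem α :=
  { m with blocks := Function.update m.blocks v (Function.update (m.blocks v) i (some B)) }

/-- The memory after `v.blocks[i].super := s`. -/
def Mem.setSuper {α : Type} (m : Mem α) (v : Addr) (i s : ℕ) : Mem α :=
  { m with super := Function.update m.super v (Function.update (m.super v) i (some s)) }

/-- The memory after `v.head := h`. -/
def Mem.setHead {α : Type} (m : Mem α) (v : Addr) (h : ℕ) : Mem α :=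
  { m with head := Function.update m.head v h }

variable {p : ℕ} {α : Type} (T : OrderingTree p)

open Classical in
/-- The index of the last block of `v`. -/
noncomputable def Mem.last (m : Mem α) (v : Addr) : ℕ :=
  if m.blocks v (m.head v) = none then m.head v - 1 else m.head v

/-- How a leaf block continues the operation sequence and the sums of its predecessor. -/
def LeafStep (B B' : Block α) (o : Option (Op α)) : Prop :=
  (∃ x, B'.element = some x ∧ o = some (.enq x) ∧ B'.sumEnq = B.sumEnq + 1 ∧
    B'.sumDeq = B.sumDeq) ∨
  (B'.element = none ∧ o = some .deq ∧ B'.sumEnq = B.sumEnq ∧ B'.sumDeq = B.sumDeq + 1)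

/-- The invariant of the shared memory. -/
structure Inv (w : World p α) : Prop where
  head_pos : ∀ v, 1 ≤ w.head v
  -- Together with `ne_none`: the head lags behind the blocks by at most one entry, the one at index
  -- `head`, which may or may not be filled.
  eq_none : ∀ {v i}, w.head v < i → w.blocks v i = none
  ne_none : ∀ {v i}, i < w.head v → w.blocks v i ≠ none
  zero : ∀ v, w.blocks v 0 = some {}
  sums : ∀ {v i B B'}, w.blocks v i = some B → w.blocks v (i + 1) = some B' →
    B.sumEnq ≤ B'.sumEnq ∧ B.sumDeq ≤ B'.sumDeq ∧ B.sumEnq + B.sumDeq < B'.sumEnq + B'.sumDeq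
  ends_mono : ∀ {v i B B'}, ¬ T.IsLeaf v → w.blocks v i = some B → w.blocks v (i + 1) = some B' →
    ∀ d, B.endDir d ≤ B'.endDir d
  ends_lt : ∀ {v i B}, ¬ T.IsLeaf v → w.blocks v i = some B → ∀ d, B.endDir d < w.head (d :: v)
  node_sum : ∀ {v i B L R}, ¬ T.IsLeaf v → w.blocks v i = some B →
    w.blocks (false :: v) B.endLeft = some L → w.blocks (true :: v) B.endRight = some R →
    B.sumEnq = L.sumEnq + R.sumEnq ∧ B.sumDeq = L.sumDeq + R.sumDeq
  size : ∀ {i B B'}, w.blocks [] i = some B → w.blocks [] (i + 1) = some B' →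
    B'.size = max 0 (B.size + (B'.sumEnq - B.sumEnq) - (B'.sumDeq - B.sumDeq))
  leaf : ∀ {k i B B'}, w.blocks (T.leaf k) i = some B → w.blocks (T.leaf k) (i + 1) = some B' →
    LeafStep B B' (w.ops k)[i]?
  super_ne_none : ∀ {d u i}, 1 ≤ i → i < w.head (d :: u) → w.super (d :: u) i ≠ none
  super_block : ∀ {v i}, w.super v i ≠ none → w.blocks v i ≠ none
  -- The parent's block that contains block `b` has index `s` or `s + 1`: the blocks before `s` end
  -- too early, and `b` was present when the head of the parent became `s + 1`, so by `snap_le` the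
  -- block `s + 1` reaches `b`.
  super_spec : ∀ {d u b s}, w.super (d :: u) b = some s → s ≤ w.head u ∧
    (∀ i < s, ∀ B, w.blocks u i = some B → B.endDir d < b) ∧
    (s + 1 ≤ w.head u → b ≤ w.snap u (s + 1) d)
  -- Holds because a refresh for index `h` reads the head of `u` after it became `h`, and advances
  -- the children before it reads their heads.
  snap_le : ∀ {u h B}, ¬ T.IsLeaf u → 1 ≤ h → w.blocks u h = some B →
    ∀ d, w.snap u h d ≤ B.endDir d
  snap_block : ∀ {u h}, h ≤ w.head u → ∀ d, w.blocks (d :: u) (w.snap u h d) ≠ none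

/-- The evolution of the world. -/
structure Le (w w' : World p α) : Prop where
  head : ∀ v, w.head v ≤ w'.head v
  blocks : ∀ {v i B}, w.blocks v i = some B → w'.blocks v i = some B
  super : ∀ {v i s}, w.super v i = some s → w'.super v i = some s
  snap_eq : ∀ {u h}, h ≤ w.head u → ∀ d, w'.snap u h d = w.snap u h d
  -- A head that reaches `h` only after `w` takes its snapshot after `w`, so the snapshot includes
  -- all blocks of `w`.
  snap_ge : ∀ {u h d b}, w.head u < h → h ≤ w'.head u → w.blocks (d :: u) b ≠ none →
    b ≤ w'.snap u h d
  ops : ∀ k, w.ops k <+: w'.ops k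

theorem Le.refl (w : World p α) : Le w w where
  head _ := le_rfl
  blocks h := h
  super h := h
  snap_eq _ _ := rfl
  snap_ge h h' _ := absurd h' (by omega)
  ops _ := List.prefix_rfl

theorem Le.block_ne {w w' : World p α} (h : Le w w') {v : Addr} {i : ℕ}
    (hb : w.blocks v i ≠ none) : w'.blocks v i ≠ none := by
  obtain ⟨B, hB⟩ := Option.ne_none_iff_exists'.1 hb
  simp [h.blocks hB]

theorem Le.trans {w₁ w₂ w₃ : World p α} (h : Le w₁ w₂) (h' : Le w₂ w₃) : Le w₁ w₃ where
  head v := (h.head v).trans (h'.head v)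
  blocks hb := h'.blocks (h.blocks hb)
  super hb := h'.super (h.super hb)
  snap_eq hh d := (h'.snap_eq (hh.trans (h.head _)) d).trans (h.snap_eq hh d)
  snap_ge {u x d b} h1 h2 h3 := by
    rcases le_or_gt x (w₂.head u) with h4 | h4
    · rw [h'.snap_eq h4]; exact h.snap_ge h1 h4 h3
    · exact h'.snap_ge h4 h2 (h.block_ne h3)
  ops k := (h.ops k).trans (h'.ops k)

/-- What process `k` relies on when other processes take steps. -/
structure Rely (k : Fin p) (w w' : World p α) : Prop where
  le : Le w w'
  inv : Inv T w'
  leaf : ∀ i, w'.blocks (T.leaf k) i = w.blocks (T.leaf k) i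
  ops : w'.ops k = w.ops k

/-- What process `k` guarantees about its own steps. -/
structure Guar (k : Fin p) (w w' : World p α) : Prop where
  le : Le w w'
  inv : Inv T w'
  leaf : ∀ j ≠ k, ∀ i, w'.blocks (T.leaf j) i = w.blocks (T.leaf j) i
  ops : w'.ops = w.ops

variable {T}

theorem Rely.refl {k : Fin p} {w : World p α} (h : Inv T w) : Rely T k w w :=
  ⟨Le.refl w, h, fun _ => rfl, rfl⟩

theorem Rely.trans {k : Fin p} {w₁ w₂ w₃ : World p α} (h : Rely T k w₁ w₂) (h' : Rely T k w₂ w₃) :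
    Rely T k w₁ w₃ :=
  ⟨h.le.trans h'.le, h'.inv, fun i => (h'.leaf i).trans (h.leaf i), h'.ops.trans h.ops⟩

/-- The compatibility condition that makes rely-guarantee reasoning sound. -/
theorem Guar.rely {j k : Fin p} {w w' : World p α} (h : Guar T k w w') (hj : j ≠ k) :
    Rely T j w w' :=
  ⟨h.le, h.inv, h.leaf j hj, by rw [h.ops]⟩

/-! ### Weakest preconditions -/

variable (T) in
/-- From the world `w` on, whatever the other processes do, process `k` can run the program without
dereferencing null, its steps meet the guarantee, and if it returns `r` in the world `w'`
then `Q r w'`. -/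
def wp (k : Fin p) {R : Type} (Q : R → World p α → Prop) : Prog α R → World p α → Prop
  | .ret r, w => Q r w
  | .crash, _ => False
  | .readHead v f, w => ∀ w', Rely T k w w' → wp k Q (f (w'.head v)) w'
  | .readBlock v i f, w => ∀ w', Rely T k w w' → wp k Q (f (w'.blocks v i)) w'
  | .readSuper v i f, w => ∀ w', Rely T k w w' →
      w'.blocks v i ≠ none ∧ wp k Q (f (w'.super v i)) w'
  -- The step prescribes the memory of the new world only; its auxiliary part is chosen by the
  -- proof.
  | .writeBlock v i B f, w => ∀ w', Rely T k w w' →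
      ∃ w'', w''.toMem = w'.setBlock v i B ∧ Guar T k w' w'' ∧ wp k Q f w''
  | .casBlock v i B f, w => ∀ w', Rely T k w w' →
      (w'.blocks v i = none →
        ∃ w'', w''.toMem = w'.setBlock v i B ∧ Guar T k w' w'' ∧ wp k Q (f true) w'') ∧
      (w'.blocks v i ≠ none → wp k Q (f false) w')
  | .casSuper v i s f, w => ∀ w', Rely T k w w' →
      w'.blocks v i ≠ none ∧
      (w'.super v i = none → ∃ w'', w''.toMem = w'.setSuper v i s ∧
        Guar T k w' w'' ∧ wp k Q f w'') ∧
      (w'.super v i ≠ none → wp k Q f w')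
  | .casHead v h f, w => ∀ w', Rely T k w w' →
      (w'.head v = h → ∃ w'', w''.toMem = w'.setHead v (h + 1) ∧
        Guar T k w' w'' ∧ wp k Q f w'') ∧
      (w'.head v ≠ h → wp k Q f w')

section WP

variable {k : Fin p} {R S : Type}

theorem wp_bind {Q : S → World p α → Prop} (P : Prog α R) (f : R → Prog α S) (w : World p α) :
    wp T k Q (P.bind f) w ↔ wp T k (fun r w' => wp T k Q (f r) w') P w := by
  induction P generalizing w <;> simp_all [Prog.bind, wp]

theorem wp_mono {Q Q' : R → World p α → Prop} (hQ : ∀ r w, Q r w → Q' r w) (P : Prog α R)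
    (w : World p α) (h : wp T k Q P w) : wp T k Q' P w := by
  induction P generalizing w with
  | ret r => exact hQ _ _ h
  | crash => exact h
  | readHead v f ih => exact fun w' hw => ih _ _ (h w' hw)
  | readBlock v i f ih => exact fun w' hw => ih _ _ (h w' hw)
  | readSuper v i f ih => exact fun w' hw => ⟨(h w' hw).1, ih _ _ (h w' hw).2⟩
  | writeBlock v i B f ih =>
    intro w' hw
    obtain ⟨w'', h1, h2, h3⟩ := h w' hw
    exact ⟨w'', h1, h2, ih _ h3⟩
  | casBlock v i B f ih =>
    intro w' hw
    refine ⟨fun hn => ?_, fun hn => ih _ _ ((h w' hw).2 hn)⟩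
    obtain ⟨w'', h1, h2, h3⟩ := (h w' hw).1 hn
    exact ⟨w'', h1, h2, ih _ _ h3⟩
  | casSuper v i s f ih =>
    intro w' hw
    refine ⟨(h w' hw).1, fun hn => ?_, fun hn => ih _ ((h w' hw).2.2 hn)⟩
    obtain ⟨w'', h1, h2, h3⟩ := (h w' hw).2.1 hn
    exact ⟨w'', h1, h2, ih _ h3⟩
  | casHead v i f ih =>
    intro w' hw
    refine ⟨fun hn => ?_, fun hn => ih _ ((h w' hw).2 hn)⟩
    obtain ⟨w'', h1, h2, h3⟩ := (h w' hw).1 hn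
    exact ⟨w'', h1, h2, ih _ h3⟩

/-- Every access already quantifies over all interference, so further interference is absorbed by
transitivity. Only a program that has returned needs a stable postcondition. -/
theorem wp_rely {Q : R → World p α → Prop}
    (hQ : ∀ r w w', Rely T k w w' → Q r w → Q r w') {P : Prog α R}
    {w w' : World p α} (hw : Rely T k w w') (h : wp T k Q P w) : wp T k Q P w' := by
  cases P with
  | ret r => exact hQ _ _ _ hw h
  | crash => exact h
  | _ => exact fun w'' hw'' => h w'' (hw.trans hw'')

/-- The link to the operational semantics: the absence of interference is a special case of
interference, so the clause of `wp` for the next access applies to the present world itself. -/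
theorem wp_step {Q : R → World p α → Prop} {P P' : Prog α R} {w : World p α} {m : Mem α}
    (hw : Inv T w) (h : wp T k Q P w) (hs : P.step w.toMem = some (m, P')) :
    ∃ w', w'.toMem = m ∧ Guar T k w w' ∧ wp T k Q P' w' := by
  have hr : Rely T k w w := Rely.refl hw
  have hg : Guar T k w w := ⟨Le.refl w, hw, fun _ _ _ => rfl, rfl⟩
  cases P with
  | ret r => simp [Prog.step] at hs
  | crash => simp [Prog.step] at hs
  | readHead v f =>
    simp only [Prog.step, Option.some.injEq, Prod.mk.injEq] at hs
    obtain ⟨rfl, rfl⟩ := hs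
    exact ⟨w, rfl, hg, h w hr⟩
  | readBlock v i f =>
    simp only [Prog.step, Option.some.injEq, Prod.mk.injEq] at hs
    obtain ⟨rfl, rfl⟩ := hs
    exact ⟨w, rfl, hg, h w hr⟩
  | readSuper v i f =>
    obtain ⟨B, hB⟩ := Option.ne_none_iff_exists'.1 (h w hr).1
    simp only [Prog.step, hB, Option.some.injEq, Prod.mk.injEq] at hs
    obtain ⟨rfl, rfl⟩ := hs
    exact ⟨w, rfl, hg, (h w hr).2⟩
  | writeBlock v i B f =>
    simp only [Prog.step, Option.some.injEq, Prod.mk.injEq] at hs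
    obtain ⟨rfl, rfl⟩ := hs
    exact h w hr
  | casBlock v i B f =>
    have h' := h w hr
    cases hb : w.blocks v i with
    | none =>
      simp only [Prog.step, hb, Option.some.injEq, Prod.mk.injEq] at hs
      obtain ⟨rfl, rfl⟩ := hs
      exact h'.1 hb
    | some B' =>
      simp only [Prog.step, hb, Option.some.injEq, Prod.mk.injEq] at hs
      obtain ⟨rfl, rfl⟩ := hs
      exact ⟨w, rfl, hg, h'.2 (by simp [hb])⟩
  | casSuper v i s f =>
    have h' := h w hr
    obtain ⟨B, hB⟩ := Option.ne_none_iff_exists'.1 h'.1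
    cases hb : w.super v i with
    | none =>
      simp only [Prog.step, hB, hb, Option.some.injEq, Prod.mk.injEq] at hs
      obtain ⟨rfl, rfl⟩ := hs
      exact h'.2.1 hb
    | some B' =>
      simp only [Prog.step, hB, hb, Option.some.injEq, Prod.mk.injEq] at hs
      obtain ⟨rfl, rfl⟩ := hs
      exact ⟨w, rfl, hg, h'.2.2 (by simp [hb])⟩
  | casHead v i f =>
    have h' := h w hr
    by_cases hb : w.head v = i
    · simp only [Prog.step, if_pos hb, Option.some.injEq, Prod.mk.injEq] at hs
      obtain ⟨rfl, rfl⟩ := hs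
      exact h'.1 hb
    · simp only [Prog.step, if_neg hb, Option.some.injEq, Prod.mk.injEq] at hs
      obtain ⟨rfl, rfl⟩ := hs
      exact ⟨w, rfl, hg, h'.2 hb⟩

variable (T k) in
/-- From any world that `k` may find after `w`, process `k` can run the program `P`, changing nothing
in its own leaf but the head, and any result satisfies `Post`. -/
def Spec (w : World p α) (P : Prog α R) (Post : R → World p α → Prop) : Prop :=
  ∀ w', Rely T k w w' → wp T k (fun r w'' => Rely T k w w'' ∧ Post r w'') P w'

theorem Spec.bind {w : World p α} {P : Prog α R} {f : R → Prog α S}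
    {Post : R → World p α → Prop} {Post' : S → World p α → Prop} (h : Spec T k w P Post)
    (h' : ∀ r w', Rely T k w w' → Post r w' → Spec T k w' (f r) Post') :
    Spec T k w (P >>= f) Post' := by
  intro w' hw
  refine (wp_bind _ _ _).2 (wp_mono ?_ _ _ (h w' hw))
  rintro r w'' ⟨h1, h2⟩
  exact wp_mono (fun s w₃ h3 => ⟨h1.trans h3.1, h3.2⟩) _ _ (h' r w'' h1 h2 w'' (Rely.refl h1.inv))

/-- As `Post` does not mention the world, the continuation is still specified from `w`, and facts
about `w` need not be transported to a later world. -/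
theorem Spec.bind_const {w : World p α} {P : Prog α R} {f : R → Prog α S}
    {Post : R → Prop} {Post' : S → World p α → Prop} (h : Spec T k w P fun r _ => Post r)
    (h' : ∀ r, Post r → Spec T k w (f r) Post') : Spec T k w (P >>= f) Post' :=
  fun w' hw => (wp_bind _ _ _).2 <|
    wp_mono (fun r w'' hr => h' r hr.2 w'' hr.1) _ _ (h w' hw)

theorem Spec.mono {w : World p α} {P : Prog α R} {Post Post' : R → World p α → Prop}
    (h : Spec T k w P Post) (h' : ∀ r w', Rely T k w w' → Post r w' → Post' r w') :
    Spec T k w P Post' :=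
  fun w' hw => wp_mono (fun r w'' hr => ⟨hr.1, h' r w'' hr.1 hr.2⟩) _ _ (h w' hw)

theorem Spec.pure {w : World p α} {r : R} {Post : R → World p α → Prop}
    (h : ∀ w', Rely T k w w' → Post r w') : Spec T k w (pure r) Post :=
  fun w' hw => ⟨hw, h w' hw⟩

end WP

/-! ### Preservation of the invariant by single writes -/

section Preservation

variable {p : ℕ} {α : Type} {T : OrderingTree p} {w : World p α}

namespace Inv

theorem le_head (hw : Inv T w) {v : Addr} {i : ℕ} (h : w.blocks v i ≠ none) : i ≤ w.head v := by
  by_contra hc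
  exact h (hw.eq_none (by omega))

/-- `eq_none` and `ne_none` leave only the entry at the head undetermined, and `last` is defined by
cases on it. -/
theorem ne_none_iff (hw : Inv T w) {v : Addr} {i : ℕ} :
    w.blocks v i ≠ none ↔ i ≤ w.last v := by
  have h1 := hw.head_pos v
  unfold Mem.last
  constructor
  · intro h
    have h2 := hw.le_head h
    split_ifs with h3
    · rcases h2.eq_or_lt with rfl | h4
      · exact absurd h3 h
      · omega
    · exact h2
  · intro h
    split_ifs at h with h3
    · exact hw.ne_none (by omega)
    · rcases h.eq_or_lt with rfl | h4
      · exact h3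
      · exact hw.ne_none h4

theorem exists_block (hw : Inv T w) {v : Addr} {i j : ℕ} (hij : i ≤ j) {B : Block α}
    (h : w.blocks v j = some B) : ∃ B', w.blocks v i = some B' := by
  rw [← Option.ne_none_iff_exists', hw.ne_none_iff]
  exact hij.trans (hw.ne_none_iff.1 (by simp [h]))

theorem exists_of_lt (hw : Inv T w) {v : Addr} {i : ℕ} (h : i < w.head v) :
    ∃ B, w.blocks v i = some B :=
  Option.ne_none_iff_exists'.1 (hw.ne_none h)

theorem sums_mono (hw : Inv T w) {v : Addr} {i j : ℕ} (hij : i ≤ j) {B B' : Block α}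
    (h : w.blocks v i = some B) (h' : w.blocks v j = some B') :
    B.sumEnq ≤ B'.sumEnq ∧ B.sumDeq ≤ B'.sumDeq := by
  induction j, hij using Nat.le_induction generalizing B' with
  | base => simp_all
  | succ j hij ih =>
    obtain ⟨C, hC⟩ := hw.exists_block (Nat.le_succ j) h'
    have h1 := ih hC
    have h2 := hw.sums hC h'
    omega

/-- Strictness lets a refresh that finds equal sums conclude that there is no new subblock. -/
theorem sums_lt (hw : Inv T w) {v : Addr} {i j : ℕ} (hij : i < j) {B B' : Block α}
    (h : w.blocks v i = some B) (h' : w.blocks v j = some B') :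
    B.sumEnq + B.sumDeq < B'.sumEnq + B'.sumDeq := by
  obtain ⟨C, hC⟩ := hw.exists_block (show i + 1 ≤ j from hij) h'
  have h1 := hw.sums h hC
  have h2 := hw.sums_mono hij hC h'
  omega

theorem endDir_mono (hw : Inv T w) {v : Addr} (hv : ¬ T.IsLeaf v) {i j : ℕ} (hij : i ≤ j)
    {B B' : Block α} (h : w.blocks v i = some B) (h' : w.blocks v j = some B') (d : Bool) :
    B.endDir d ≤ B'.endDir d := by
  induction j, hij using Nat.le_induction generalizing B' with
  | base => simp_all
  | succ j hij ih =>
    obtain ⟨C, hC⟩ := hw.exists_block (Nat.le_succ j) h'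
    exact (ih hC).trans (hw.ends_mono hv hC h' d)

end Inv

@[simp] theorem Mem.setBlock_head (m : Mem α) (v : Addr) (i : ℕ) (B : Block α) :
    (m.setBlock v i B).head = m.head := rfl

theorem Mem.setBlock_blocks (m : Mem α) (v x : Addr) (i j : ℕ) (B : Block α) :
    (m.setBlock v i B).blocks x j = if x = v ∧ j = i then some B else m.blocks x j := by
  unfold Mem.setBlock
  by_cases hx : x = v
  · subst hx
    by_cases hj : j = i <;> simp [hj]
  · simp [hx]

/-- What makes a block fit into the first free entry of `v.blocks`. -/
structure Fits (T : OrderingTree p) (w : World p α) (v : Addr) (h : ℕ) (B' B : Block α) :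
    Prop where
  prev : w.blocks v (h - 1) = some B'
  pos : 1 ≤ h
  sums : B'.sumEnq ≤ B.sumEnq ∧ B'.sumDeq ≤ B.sumDeq ∧
    B'.sumEnq + B'.sumDeq < B.sumEnq + B.sumDeq
  ends : ¬ T.IsLeaf v → ∀ d, B'.endDir d ≤ B.endDir d ∧ B.endDir d < w.head (d :: v) ∧
    w.snap v h d ≤ B.endDir d
  node_sum : ¬ T.IsLeaf v → ∀ L R, w.blocks (false :: v) B.endLeft = some L →
    w.blocks (true :: v) B.endRight = some R →
    B.sumEnq = L.sumEnq + R.sumEnq ∧ B.sumDeq = L.sumDeq + R.sumDeq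
  size : v = [] →
    B.size = max 0 (B'.size + (B.sumEnq - B'.sumEnq) - (B.sumDeq - B'.sumDeq))
  leaf : ∀ k, T.leaf k = v → LeafStep B' B (w.ops k)[h - 1]?

theorem Le.setBlock {v : Addr} {h : ℕ} {B : Block α} (hn : w.blocks v h = none) :
    Le w { w with toMem := w.setBlock v h B } where
  head _ := le_rfl
  blocks {x i C} hC := by
    simp only [Mem.setBlock_blocks]
    rw [if_neg]
    · exact hC
    · rintro ⟨rfl, rfl⟩
      simp_all
  super h := h
  snap_eq _ _ := rfl
  snap_ge h h' _ := absurd h' (by simpa using h)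
  ops _ := List.prefix_rfl

/-- The entry that is filled is the one at the head, so the only new pair of consecutive blocks
consists of `B'` and `B`, and `Fits` says what is needed of it. -/
theorem Inv.setBlock (hw : Inv T w) {v : Addr} {h : ℕ} {B B' : Block α} (hh : h ≤ w.head v)
    (hn : w.blocks v h = none) (hf : Fits T w v h B' B) :
    Inv T { w with toMem := w.setBlock v h B } := by
  have hhead : w.head v = h := by
    rcases hh.eq_or_lt with h1 | h1
    · exact h1.symm
    · exact absurd hn (hw.ne_none h1)
  have hle : Le w { w with toMem := w.setBlock v h B } := Le.setBlock hn
  have hpos := hf.pos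
  have hnew : ∀ {x i C}, (w.setBlock v h B).blocks x i = some C →
      (x = v ∧ i = h ∧ C = B) ∨ (w.blocks x i = some C) := by
    intro x i C hC
    rw [Mem.setBlock_blocks] at hC
    split_ifs at hC with h1
    · left; exact ⟨h1.1, h1.2, by simpa using hC.symm⟩
    · right; exact hC
  have hpair : ∀ {x i C C'}, (w.setBlock v h B).blocks x i = some C →
      (w.setBlock v h B).blocks x (i + 1) = some C' →
      (x = v ∧ i + 1 = h ∧ C = B' ∧ C' = B) ∨
        (w.blocks x i = some C ∧ w.blocks x (i + 1) = some C') := by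
    intro x i C C' hC hC'
    rcases hnew hC with ⟨rfl, rfl, rfl⟩ | h1
    · rcases hnew hC' with ⟨_, h3, _⟩ | h2
      · omega
      · have := hw.eq_none (show w.head x < i + 1 by omega)
        simp_all
    · rcases hnew hC' with ⟨rfl, rfl, rfl⟩ | h2
      · left
        have := hf.prev
        simp_all
      · exact Or.inr ⟨h1, h2⟩
  refine
    { head_pos := hw.head_pos
      eq_none := ?_, ne_none := ?_, zero := fun x => hle.blocks (hw.zero x), sums := ?_,
      ends_mono := ?_, ends_lt := ?_, node_sum := ?_, size := ?_, leaf := ?_,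
      super_ne_none := hw.super_ne_none,
      super_block := fun h => hle.block_ne (hw.super_block h),
      super_spec := ?_, snap_le := ?_,
      snap_block := fun h d => hle.block_ne (hw.snap_block h d) }
  · intro x i hi
    simp only [Mem.setBlock_head] at hi
    simp only [Mem.setBlock_blocks]
    rw [if_neg]
    · exact hw.eq_none hi
    · rintro ⟨rfl, rfl⟩; omega
  · exact fun hi => hle.block_ne (hw.ne_none hi)
  · intro x i C C' hC hC'
    rcases hpair hC hC' with ⟨rfl, rfl, rfl, rfl⟩ | ⟨h1, h2⟩
    · exact hf.sums
    · exact hw.sums h1 h2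
  · intro x i C C' hx hC hC' d
    rcases hpair hC hC' with ⟨rfl, rfl, rfl, rfl⟩ | ⟨h1, h2⟩
    · exact (hf.ends hx d).1
    · exact hw.ends_mono hx h1 h2 d
  · intro x i C hx hC d
    rcases hnew hC with ⟨rfl, rfl, rfl⟩ | h1
    · exact (hf.ends hx d).2.1
    · exact hw.ends_lt hx h1 d
  · intro x i C L R hx hC hL hR
    -- If `x` is the parent of `v`, the subblock in question lies below the head of `v`, where no
    -- entry changes.
    have key : ∀ d j D, (w.setBlock v h B).blocks (d :: x) j = some D → j < w.head (d :: x) →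
        w.blocks (d :: x) j = some D := by
      intro d j D hD hlt
      obtain ⟨E, hE⟩ := hw.exists_of_lt hlt
      have := hle.blocks hE
      simp_all
    have hend : ∀ d, C.endDir d < w.head (d :: x) := by
      rcases hnew hC with ⟨rfl, rfl, rfl⟩ | h1
      · exact fun d => (hf.ends hx d).2.1
      · exact hw.ends_lt hx h1
    have hL' := key _ _ _ hL (hend false)
    have hR' := key _ _ _ hR (hend true)
    rcases hnew hC with ⟨rfl, rfl, rfl⟩ | h1
    · exact hf.node_sum hx _ _ hL' hR'
    · exact hw.node_sum hx h1 hL' hR'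
  · intro i C C' hC hC'
    rcases hpair hC hC' with ⟨rfl, rfl, rfl, rfl⟩ | ⟨h1, h2⟩
    · exact hf.size rfl
    · exact hw.size h1 h2
  · intro k i C C' hC hC'
    rcases hpair hC hC' with ⟨hx, rfl, rfl, rfl⟩ | ⟨h1, h2⟩
    · simpa using hf.leaf k hx
    · exact hw.leaf h1 h2
  · intro d u b s hs
    have hsp := hw.super_spec hs
    refine ⟨hsp.1, fun i hi C hC => ?_, hsp.2.2⟩
    rcases hnew hC with ⟨rfl, rfl, rfl⟩ | h1
    -- The new block has index `w.head u`, and `s` is at most that.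
    · omega
    · exact hsp.2.1 i hi C h1
  · intro u i C hu hi hC d
    rcases hnew hC with ⟨rfl, rfl, rfl⟩ | h1
    · exact (hf.ends hu d).2.2
    · exact hw.snap_le hu hi h1 d

/-- The world after `u.head` became `h + 1`. -/
noncomputable def World.setHead (w : World p α) (u : Addr) (h : ℕ) : World p α where
  toMem := w.toMem.setHead u (h + 1)
  snap := Function.update w.snap u
    (Function.update (w.snap u) (h + 1) fun d => w.last (d :: u))
  ops := w.ops

theorem World.setHead_head (w : World p α) (u x : Addr) (h : ℕ) :
    (w.setHead u h).head x = if x = u then h + 1 else w.head x := by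
  simp [World.setHead, Mem.setHead, Function.update_apply]

theorem World.setHead_snap (w : World p α) (u x : Addr) (h i : ℕ) (d : Bool) :
    (w.setHead u h).snap x i d = if x = u ∧ i = h + 1 then w.last (d :: u) else w.snap x i d := by
  by_cases hx : x = u
  · subst hx
    by_cases hj : i = h + 1 <;> simp [World.setHead, hj]
  · simp [World.setHead, hx]

theorem Le.setHead (hw : Inv T w) {u : Addr} {h : ℕ} (hh : w.head u = h) :
    Le w (w.setHead u h) where
  head x := by rw [World.setHead_head]; split_ifs with h1 <;> simp_all
  blocks h := h
  super h := h
  snap_eq {x i} hi d := by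
    rw [World.setHead_snap, if_neg]
    rintro ⟨rfl, rfl⟩; omega
  snap_ge {x i d b} hi hi' hb := by
    rw [World.setHead_head] at hi'
    split_ifs at hi' with h1
    · rw [World.setHead_snap, if_pos ⟨h1, by subst h1; omega⟩]
      subst h1
      exact hw.ne_none_iff.1 hb
    · omega
  ops _ := List.prefix_rfl

theorem Inv.setHead (hw : Inv T w) {u : Addr} {h : ℕ} (hh : w.head u = h)
    (hb : w.blocks u h ≠ none) (hs : u ≠ [] → w.super u h ≠ none) :
    Inv T (w.setHead u h) := by
  have hle := Le.setHead hw hh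
  have hhead : ∀ x, w.head x ≤ (w.setHead u h).head x := hle.head
  refine
    { head_pos := fun x => (hw.head_pos x).trans (hhead x)
      eq_none := fun hi => hw.eq_none ((hhead _).trans_lt hi)
      ne_none := ?_, zero := hw.zero, sums := hw.sums, ends_mono := hw.ends_mono
      ends_lt := fun hv hB d => (hw.ends_lt hv hB d).trans_le (hhead _)
      node_sum := hw.node_sum, size := hw.size, leaf := hw.leaf, super_ne_none := ?_
      super_block := hw.super_block, super_spec := ?_, snap_le := ?_, snap_block := ?_ }
  · intro v i hi
    rw [World.setHead_head] at hi
    split_ifs at hi with h1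
    · subst h1
      rcases (Nat.lt_succ_iff.1 hi).eq_or_lt with rfl | h2
      · exact hb
      · exact hw.ne_none (by omega)
    · exact hw.ne_none hi
  · intro d v i hi hi'
    rw [World.setHead_head] at hi'
    split_ifs at hi' with h1
    · rcases (Nat.lt_succ_iff.1 hi').eq_or_lt with rfl | h2
      · rw [h1]; exact hs (by simp [← h1])
      · exact hw.super_ne_none hi (by rw [h1]; omega)
    · exact hw.super_ne_none hi hi'
  · intro d v b s hsb
    have hsp := hw.super_spec hsb
    change w.super (d :: v) b = some s at hsb
    refine ⟨hsp.1.trans (hhead v), hsp.2.1, fun hle' => ?_⟩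
    rw [World.setHead_snap]
    split_ifs with h1
    -- The head becomes `s + 1` at this very moment, and the block with super `s` already exists, so
    -- the snapshot includes it.
    · have h2 := hw.ne_none_iff.1 (hw.super_block (by rw [hsb]; simp))
      rw [← h1.1]; exact h2
    · apply hsp.2.2
      rw [World.setHead_head] at hle'
      split_ifs at hle' with h2
      · subst h2
        have : s + 1 ≠ h + 1 := fun h3 => h1 ⟨rfl, h3⟩
        omega
      · exact hle'
  · intro v i B hv hi hB d
    rw [World.setHead_snap, if_neg]
    · exact hw.snap_le hv hi hB d
    · rintro ⟨rfl, rfl⟩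
      -- The new snapshot belongs to the index `h + 1`, where there is no block yet.
      have := hw.eq_none (show w.head v < h + 1 by omega)
      exact absurd hB (by change w.blocks v (h + 1) ≠ _; simp [this])
  · intro v i hi d
    rw [World.setHead_snap]
    split_ifs with h1
    · rw [h1.1]
      exact hw.ne_none_iff.2 le_rfl
    · apply hw.snap_block
      rw [World.setHead_head] at hi
      split_ifs at hi with h2
      · subst h2
        have : i ≠ h + 1 := fun h3 => h1 ⟨rfl, h3⟩
        omega
      · exact hi

theorem Mem.setSuper_super (m : Mem α) (v x : Addr) (i j s : ℕ) :
    (m.setSuper v i s).super x j = if x = v ∧ j = i then some s else m.super x j := by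
  unfold Mem.setSuper
  by_cases hx : x = v
  · subst hx
    by_cases hj : j = i <;> simp [hj]
  · simp [hx]

theorem Le.setSuper {v : Addr} {i s : ℕ} (hn : w.super v i = none) :
    Le w { w with toMem := w.setSuper v i s } where
  head _ := le_rfl
  blocks h := h
  super {x j t} ht := by
    simp only [Mem.setSuper_super]
    rw [if_neg]
    · exact ht
    · rintro ⟨rfl, rfl⟩
      simp_all
  snap_eq _ _ := rfl
  snap_ge h h' _ := absurd h' (not_le.2 h)
  ops _ := List.prefix_rfl

theorem Inv.setSuper (hw : Inv T w) {d : Bool} {u : Addr} {b s : ℕ}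
    (hb : w.blocks (d :: u) b ≠ none) (hn : w.super (d :: u) b = none)
    (hs : s ≤ w.head u ∧ (∀ i < s, ∀ B, w.blocks u i = some B → B.endDir d < b) ∧
      (s + 1 ≤ w.head u → b ≤ w.snap u (s + 1) d)) :
    Inv T { w with toMem := w.setSuper (d :: u) b s } := by
  have hle : Le w { w with toMem := w.setSuper (d :: u) b s } := Le.setSuper hn
  refine
    { head_pos := hw.head_pos, eq_none := hw.eq_none, ne_none := hw.ne_none, zero := hw.zero,
      sums := hw.sums, ends_mono := hw.ends_mono, ends_lt := hw.ends_lt, node_sum := hw.node_sum,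
      size := hw.size, leaf := hw.leaf, super_ne_none := ?_, super_block := ?_, super_spec := ?_,
      snap_le := hw.snap_le, snap_block := hw.snap_block }
  · intro e v i hi hi'
    obtain ⟨t, ht⟩ := Option.ne_none_iff_exists'.1 (hw.super_ne_none hi hi')
    rw [hle.super ht]
    simp
  · intro v i hi
    simp only [Mem.setSuper_super] at hi
    split_ifs at hi with h1
    · rw [h1.1, h1.2]; exact hb
    · exact hw.super_block hi
  · intro e v i t ht
    simp only [Mem.setSuper_super] at ht
    split_ifs at ht with h1
    · obtain ⟨h2, rfl⟩ := h1
      obtain ⟨rfl, rfl⟩ := List.cons_eq_cons.1 h2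
      obtain rfl : s = t := by simpa using ht
      exact hs
    · exact hw.super_spec ht

end Preservation

section Procedures

variable {p : ℕ} {α : Type} {T : OrderingTree p} {w : World p α} {k : Fin p} {R : Type}

/-! ### Single accesses -/

/-- A head may grow at any time, so the continuation has to start from the world in which the head
was read. -/
theorem Spec.bind_getHead {v : Addr} {f : ℕ → Prog α R} {Post : R → World p α → Prop}
    (h : ∀ w', Rely T k w w' → Spec T k w' (f (w'.head v)) Post) :
    Spec T k w (getHead v >>= f) Post := by
  intro w' hw w'' hw'
  exact wp_mono (fun r w₃ h3 => ⟨(hw.trans hw').trans h3.1, h3.2⟩) _ _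
    (h w'' (hw.trans hw') w'' (Rely.refl hw'.inv))

theorem Spec.bind_getBlock? {v : Addr} {i : ℕ} {f : Option (Block α) → Prog α R}
    {Post : R → World p α → Prop}
    (h : ∀ w', Rely T k w w' → Spec T k w' (f (w'.blocks v i)) Post) :
    Spec T k w (getBlock? v i >>= f) Post := by
  intro w' hw w'' hw'
  exact wp_mono (fun r w₃ h3 => ⟨(hw.trans hw').trans h3.1, h3.2⟩) _ _
    (h w'' (hw.trans hw') w'' (Rely.refl hw'.inv))

/-- Blocks are permanent, so the value to be read is known from `w`, which remains the world of
reference. -/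
theorem Spec.bind_getBlock {v : Addr} {i : ℕ} {B : Block α} {f : Block α → Prog α R}
    {Post : R → World p α → Prop} (hB : w.blocks v i = some B) (h : Spec T k w (f B) Post) :
    Spec T k w (getBlock v i >>= f) Post := by
  intro w' hw w'' hw'
  have h1 := (hw.trans hw').le.blocks hB
  simp only [h1]
  exact h w'' (hw.trans hw')

theorem Spec.bind_getSuper {v : Addr} {i s : ℕ} {f : ℕ → Prog α R}
    {Post : R → World p α → Prop} (hB : w.blocks v i ≠ none) (hs : w.super v i = some s)
    (h : Spec T k w (f s) Post) :
    Spec T k w (getSuper v i >>= f) Post := by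
  intro w' hw w'' hw'
  have h1 := (hw.trans hw').le.super hs
  simp only [h1]
  exact ⟨(hw.trans hw').le.block_ne hB, h w'' (hw.trans hw')⟩

theorem Rely.setHead (hw : Inv T w) {u : Addr} {h : ℕ} (hh : w.head u = h)
    (hb : w.blocks u h ≠ none) (hs : u ≠ [] → w.super u h ≠ none) :
    Rely T k w (w.setHead u h) ∧ Guar T k w (w.setHead u h) :=
  ⟨⟨Le.setHead hw hh, hw.setHead hh hb hs, fun _ => rfl, rfl⟩,
    ⟨Le.setHead hw hh, hw.setHead hh hb hs, fun _ _ _ => rfl, rfl⟩⟩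

/-- If the CAS fails, the head differs from `h`; being at least `h` because entry `h` is filled, it
has already moved on. -/
theorem spec_tryHead {v : Addr} {h : ℕ} (hb : w.blocks v h ≠ none)
    (hs : v ≠ [] → w.super v h ≠ none) :
    Spec T k w (tryHead v h) fun _ w' => h < w'.head v := by
  intro w₁ hw₁ w₂ hw₂
  have hw := hw₁.trans hw₂
  have hb₂ := hw.le.block_ne hb
  refine ⟨fun hh => ?_, fun hh => ⟨hw, ?_⟩⟩
  · have hs₂ : v ≠ [] → w₂.super v h ≠ none := fun hv => by
      obtain ⟨s, hs⟩ := Option.ne_none_iff_exists'.1 (hs hv)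
      simp [hw.le.super hs]
    have := Rely.setHead (k := k) hw.inv hh hb₂ hs₂
    refine ⟨w₂.setHead v h, rfl, this.2, hw.trans this.1, ?_⟩
    simp [World.setHead_head]
  · have := hw.inv.le_head hb₂
    omega

/-- Here `w` is the world in which `s` was read from the head of the parent. The head may move
before the CAS, but the parent's blocks before `s` were fixed already, and block `b` existed before
the head became `s + 1`. If `super` was set already, the CAS changes nothing and nothing has to be
known about `s`. -/
theorem spec_trySuper {d : Bool} {u : Addr} {b s : ℕ} (hb : w.blocks (d :: u) b ≠ none)
    (hinv : Inv T w)
    (hs : w.super (d :: u) b = none →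
      s = w.head u ∧ ∀ i < s, ∀ B, w.blocks u i = some B → B.endDir d < b) :
    Spec T k w (trySuper (d :: u) b s) fun _ w' => w'.super (d :: u) b ≠ none := by
  intro w₁ hw₁ w₂ hw₂
  have hw := hw₁.trans hw₂
  have hb₂ := hw.le.block_ne hb
  refine ⟨hb₂, fun hn => ?_, fun hn => ⟨hw, hn⟩⟩
  have hn₀ : w.super (d :: u) b = none := by
    by_contra hc
    obtain ⟨t, ht⟩ := Option.ne_none_iff_exists'.1 hc
    simp [hw.le.super ht] at hn
  obtain ⟨rfl, hlt⟩ := hs hn₀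
  have hinv' := hw.inv.setSuper (s := w.head u) hb₂ hn ⟨hw.le.head u, fun i hi B hB => by
    obtain ⟨C, hC⟩ := hinv.exists_of_lt hi
    have := hw.le.blocks hC
    simp only [hB, Option.some.injEq] at this
    subst this
    exact hlt i hi _ hC, fun h => hw.le.snap_ge (by omega) h hb⟩
  have hle := Le.setSuper (s := w.head u) hn
  refine ⟨_, rfl, ⟨hle, hinv', fun _ _ _ => rfl, rfl⟩,
    hw.trans ⟨hle, hinv', fun _ => rfl, rfl⟩, ?_⟩
  simp [Mem.setSuper_super]

/-- A block is created some time before the CAS that installs it. It still fits then, since the ends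
lie below the heads of the children, where blocks are fixed, and the snapshot for an index up to the
head is fixed too. -/
theorem Fits.rely {w' : World p α} (hw : Inv T w) (hr : Rely T k w w') {v : Addr}
    (hv : ¬ T.IsLeaf v) {h : ℕ} (hh : h ≤ w.head v) {B' B : Block α} (hf : Fits T w v h B' B) :
    Fits T w' v h B' B where
  prev := hr.le.blocks hf.prev
  pos := hf.pos
  sums := hf.sums
  ends _ d := ⟨(hf.ends hv d).1, (hf.ends hv d).2.1.trans_le (hr.le.head _), by
    rw [hr.le.snap_eq hh]; exact (hf.ends hv d).2.2⟩
  node_sum _ L R hL hR := by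
    obtain ⟨L', hL'⟩ := hw.exists_of_lt (hf.ends hv false).2.1
    obtain ⟨R', hR'⟩ := hw.exists_of_lt (hf.ends hv true).2.1
    have h1 := hr.le.blocks hL'
    have h2 := hr.le.blocks hR'
    simp only [Block.endDir] at h1 h2
    simp only [hL, hR, Option.some.injEq] at h1 h2
    subst h1 h2
    exact hf.node_sum hv _ _ hL' hR'
  size := hf.size
  leaf j hj := absurd ⟨j, hj⟩ hv

theorem Spec.bind_tryBlock {v : Addr} {h : ℕ} {B' B : Block α} {f : Bool → Prog α R}
    {Post : R → World p α → Prop}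
    (hw : Inv T w) (hv : ¬ T.IsLeaf v) (hh : h ≤ w.head v) (hf : Fits T w v h B' B)
    (hpost : ∀ w' r, Rely T k w w' → w'.blocks v h ≠ none → (r = true → w'.blocks v h = some B) →
      Spec T k w' (f r) Post) :
    Spec T k w (tryBlock v h B >>= f) Post := by
  refine Spec.bind (Post := fun r w' => w'.blocks v h ≠ none ∧
    (r = true → w'.blocks v h = some B)) ?_ fun r w' h1 h2 => hpost w' r h1 h2.1 h2.2
  intro w₁ hw₁ w₂ hw₂
  have hr := hw₁.trans hw₂
  refine ⟨fun hn => ?_, fun hn => ⟨hr, hn, by simp⟩⟩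
  have hle := Le.setBlock (B := B) hn
  have hinv := hr.inv.setBlock (hh.trans (hr.le.head v)) hn (hf.rely hw hr hv hh)
  have hleaf : ∀ j i, (w₂.setBlock v h B).blocks (T.leaf j) i = w₂.blocks (T.leaf j) i := by
    intro j i
    rw [Mem.setBlock_blocks, if_neg]
    rintro ⟨rfl, rfl⟩
    exact hv ⟨j, rfl⟩
  refine ⟨_, rfl, ⟨hle, hinv, fun j _ i => hleaf j i, rfl⟩,
    hr.trans ⟨hle, hinv, hleaf k, rfl⟩, ?_⟩
  simp [Mem.setBlock_blocks]

/-! ### The procedures that change the memory -/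

theorem spec_advance {v : Addr} {h : ℕ} (hh : 1 ≤ h) (hb : w.blocks v h ≠ none)
    (hp : ∀ d u, v = d :: u → ¬ T.IsLeaf u) :
    Spec T k w (advance v h) fun _ w' => h < w'.head v := by
  rcases v with _ | ⟨d, u⟩
  · exact spec_tryHead hb (by simp)
  · refine Spec.bind_getHead fun w₁ hw₁ => ?_
    have hb₁ := hw₁.le.block_ne hb
    refine Spec.bind (spec_trySuper hb₁ hw₁.inv fun hn => ⟨rfl, fun i _ B hB => ?_⟩) ?_
    · have h1 := hw₁.inv.ends_lt (hp d u rfl) hB d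
      -- While `super` is null the head has not passed `h`, so no block of the parent ends at `h` or
      -- later.
      have h2 : ¬ h < w₁.head (d :: u) := fun h3 => hw₁.inv.super_ne_none hh h3 hn
      omega
    · exact fun _ w₂ hw₂ hs => spec_tryHead (hw₂.le.block_ne hb₁) fun _ => hs

theorem spec_helpAdvance {d : Bool} {u : Addr} (hu : ¬ T.IsLeaf u) :
    Spec T k w (helpAdvance (d :: u)) fun _ w' =>
      ∀ b, w.blocks (d :: u) b ≠ none → b < w'.head (d :: u) := by
  refine Spec.bind_getHead fun w₁ hw₁ => Spec.bind_getBlock? fun w₂ hw₂ => ?_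
  have hle : ∀ b, w.blocks (d :: u) b ≠ none → b ≤ w₁.head (d :: u) := fun b hb =>
    hw₁.inv.le_head (hw₁.le.block_ne hb)
  cases hb : w₂.blocks (d :: u) (w₁.head (d :: u)) with
  | some B =>
    refine (spec_advance (hw₁.inv.head_pos _) (by simp [hb]) ?_).mono
      fun _ w₃ _ h3 b hb' => (hle b hb').trans_lt h3
    rintro e x h; cases h; exact hu
  | none =>
    -- An entry that is null now was null at the start, so all the original blocks lie strictly
    -- below the head that was read.
    refine Spec.pure fun w₃ hw₃ b hb' => ?_
    rcases (hle b hb').eq_or_lt with rfl | h1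
    · exact absurd hb ((hw₁.trans hw₂).le.block_ne hb')
    · exact h1.trans_le ((hw₂.trans hw₃).le.head _)

/-- The hypothesis `hsnap` is what helping the children first achieves. It puts the ends, which are
read from the heads afterwards, at or beyond the snapshot for index `i`. -/
theorem spec_createBlock {v : Addr} {i : ℕ} {B' : Block α} (hv : ¬ T.IsLeaf v) (hi : 1 ≤ i)
    (hB' : w.blocks v (i - 1) = some B') (hw : Inv T w) (hih : i ≤ w.head v)
    (hsnap : ∀ d, w.snap v i d < w.head (d :: v)) :
    Spec T k w (createBlock v i) fun r w' =>
      match r with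
      | some B => Fits T w' v i B' B ∧ ∀ d, w.head (d :: v) - 1 ≤ B.endDir d
      | none => ∀ d, w.head (d :: v) - 1 ≤ B'.endDir d := by
  refine Spec.bind_getHead fun w₁ hw₁ => Spec.bind_getHead fun w₂ hw₂ => ?_
  have hr := hw₁.trans hw₂
  have hinv := hw₂.inv
  set eL := w₁.head (false :: v) - 1 with heL
  set eR := w₂.head (true :: v) - 1 with heR
  have h1 := hw₁.inv.head_pos (false :: v)
  have h2 := hw₂.inv.head_pos (true :: v)
  have h3 := hw₂.le.head (false :: v)
  have h4 := hw₁.le.head (false :: v)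
  have h5 := hr.le.head (true :: v)
  have hltL := hw.ends_lt hv hB' false
  have hltR := hw.ends_lt hv hB' true
  have hsL := hsnap false
  have hsR := hsnap true
  obtain ⟨L, hL⟩ := hinv.exists_of_lt (v := false :: v) (i := eL) (by omega)
  obtain ⟨R, hR⟩ := hinv.exists_of_lt (v := true :: v) (i := eR) (by omega)
  have hB₂ := hr.le.blocks hB'
  obtain ⟨L', hL'⟩ := hinv.exists_of_lt (hinv.ends_lt hv hB₂ false)
  obtain ⟨R', hR'⟩ := hinv.exists_of_lt (hinv.ends_lt hv hB₂ true)
  have hsum := hinv.node_sum hv hB₂ hL' hR'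
  have hmL := hinv.sums_mono (by simp only [heL]; omega) hL' hL
  have hmR := hinv.sums_mono (by simp only [heR]; omega) hR' hR
  have hfits : ∀ size : ℤ,
      ¬ (L.sumEnq + R.sumEnq - B'.sumEnq + (L.sumDeq + R.sumDeq - B'.sumDeq) = 0) →
      (v = [] → size = max 0 (B'.size + (L.sumEnq + R.sumEnq - B'.sumEnq) -
        (L.sumDeq + R.sumDeq - B'.sumDeq))) →
      Fits T w₂ v i B'
        ⟨L.sumEnq + R.sumEnq, L.sumDeq + R.sumDeq, eL, eR, none, size⟩ := by
    intro size hne hsize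
    refine ⟨hB₂, hi, ?_, fun _ d => ?_, fun _ L₁ R₁ hL₁ hR₁ => ?_, hsize,
      fun j hj => absurd ⟨j, hj⟩ hv⟩
    · simp only
      omega
    · rw [hr.le.snap_eq hih]
      cases d <;> simp only [Block.endDir] at hltL hltR ⊢ <;> omega
    · simp only at hL₁ hR₁ ⊢
      simp_all
  have hfin : ∀ size : ℤ, (v = [] → size = max 0 (B'.size +
        (L.sumEnq + R.sumEnq - B'.sumEnq) - (L.sumDeq + R.sumDeq - B'.sumDeq))) →
      Spec T k w₂ (if L.sumEnq + R.sumEnq - B'.sumEnq + (L.sumDeq + R.sumDeq - B'.sumDeq) = 0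
        then pure none else pure (some
          ⟨L.sumEnq + R.sumEnq, L.sumDeq + R.sumDeq, eL, eR, none, size⟩)) fun r w' =>
        match r with
        | some B => Fits T w' v i B' B ∧ ∀ d, w.head (d :: v) - 1 ≤ B.endDir d
        | none => ∀ d, w.head (d :: v) - 1 ≤ B'.endDir d := by
    intro size hsize
    split_ifs with h0
    · refine Spec.pure fun w' hw' d => ?_
      -- The ends cannot have decreased, and if one had increased, the sums would have grown
      -- strictly.
      have hL0 : B'.endDir false = eL := by
        by_contra hc
        have := hinv.sums_lt (show B'.endDir false < eL by omega) hL' hL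
        omega
      have hR0 : B'.endDir true = eR := by
        by_contra hc
        have := hinv.sums_lt (show B'.endDir true < eR by omega) hR' hR
        omega
      cases d <;> omega
    · refine Spec.pure fun w' hw' => ⟨(hfits size h0 hsize).rely hinv hw' hv
        (hih.trans (hr.le.head v)), fun d => ?_⟩
      cases d <;> simp only [Block.endDir] <;> omega
  refine Spec.bind_getBlock hL <| Spec.bind_getBlock hR <| Spec.bind_getBlock hL <|
    Spec.bind_getBlock hR <| Spec.bind_getBlock hB₂ <| Spec.bind_getBlock hB₂ ?_
  split_ifs with hnil
  · exact Spec.bind_getBlock hB₂ (hfin _ fun _ => rfl)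
  · exact hfin _ fun h => absurd h hnil

/-- The blocks that the children of `v` have in the world `w` are subblocks of blocks of `v`. -/
def Absorbed (w : World p α) (v : Addr) (w' : World p α) : Prop :=
  ∀ d b, w.blocks (d :: v) b ≠ none → ∃ j B, w'.blocks v j = some B ∧ b ≤ B.endDir d

/-- A refresh whose CAS fails still sees the head move, because the entry is then filled and
`advance` is called in either case. -/
theorem spec_refresh {v : Addr} {l r : LTree (Fin p)} (hv : T.shape.At v (.node l r)) :
    Spec T k w (refresh v) fun res w' =>
      if res then Absorbed w v w' else ∃ h, w.head v ≤ h ∧ h < w'.head v := by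
  have hnl := T.not_isLeaf hv
  refine Spec.bind_getHead fun w₁ hw₁ => ?_
  refine Spec.bind (spec_helpAdvance hnl) fun _ w₂ hw₂ hL => ?_
  refine Spec.bind (spec_helpAdvance hnl) fun _ w₃ hw₃ hR => ?_
  have h1 := hw₁.inv.head_pos v
  obtain ⟨B', hB'⟩ := hw₁.inv.exists_of_lt (v := v) (i := w₁.head v - 1) (by omega)
  have hr := hw₂.trans hw₃
  have hB₃ := hr.le.blocks hB'
  have hlt : ∀ d b, w₁.blocks (d :: v) b ≠ none → b < w₃.head (d :: v) := by
    intro d b hb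
    cases d
    · exact (hL b hb).trans_le (hw₃.le.head _)
    · exact hR b (hw₂.le.block_ne hb)
  refine Spec.bind (spec_createBlock hnl h1 hB₃ hw₃.inv (hr.le.head v) fun d => ?_)
    fun o w₄ hw₄ ho => ?_
  -- The snapshot names a block that existed when the head was read, and helping has moved the head
  -- of the child past it.
  · rw [hr.le.snap_eq le_rfl]
    exact hlt d _ (hw₁.inv.snap_block le_rfl d)
  · cases o with
    | none =>
      refine Spec.pure fun w₅ hw₅ => ?_
      simp only [if_true]
      intro d b hb
      refine ⟨_, _, (hw₄.trans hw₅).le.blocks hB₃, ?_⟩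
      have := hlt d b (hw₁.le.block_ne hb)
      have := ho d
      omega
    | some B =>
      have hh₄ := (hr.trans hw₄).le.head v
      refine Spec.bind_tryBlock hw₄.inv hnl hh₄ ho.1 fun w₅ res hw₅ hb hres => ?_
      refine Spec.bind (spec_advance h1 hb fun d u h => ?_) fun _ w₆ hw₆ hadv => ?_
      · subst h
        obtain ⟨_, _, h2, -⟩ := hv.parent
        exact T.not_isLeaf h2
      · refine Spec.pure fun w₇ hw₇ => ?_
        cases res
        · exact ⟨_, hw₁.le.head v, hadv.trans_le (hw₇.le.head v)⟩
        · intro d b hb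
          refine ⟨_, _, (hw₆.trans hw₇).le.blocks (hres rfl), ?_⟩
          have := hlt d b (hw₁.le.block_ne hb)
          have := ho.2 d
          omega

/-- The head exceeded `w.head v` once the first refresh was over, so `h₂` is a value that it took
after `w`. The snapshot for `h₂` therefore includes all blocks of `w`, and the block at `h₂` covers
the snapshot. -/
theorem absorbed_of_head_lt {v : Addr} (hv : ¬ T.IsLeaf v) {w₁ w₂ : World p α} {h₁ h₂ : ℕ}
    (hr : Rely T k w w₁) (hr' : Rely T k w₁ w₂) (h1 : w.head v ≤ h₁) (h2 : h₁ < w₁.head v)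
    (h3 : w₁.head v ≤ h₂) (h4 : h₂ < w₂.head v) : Absorbed w v w₂ := by
  intro d b hb
  obtain ⟨B, hB⟩ := hr'.inv.exists_of_lt h4
  refine ⟨_, _, hB, le_trans ?_ (hr'.inv.snap_le hv (by omega) hB d)⟩
  exact (hr.le.trans hr'.le).snap_ge (by omega) h4.le hb

/-- After two refreshes, of which the second is skipped if the first succeeds, all blocks are
propagated. -/
theorem spec_refresh_twice {v : Addr} {l r : LTree (Fin p)} (hv : T.shape.At v (.node l r))
    {f : Prog α R} {Post : R → World p α → Prop}
    (hf : ∀ w', Rely T k w w' → Absorbed w v w' → Spec T k w' f Post) :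
    Spec T k w (refresh v >>= fun b => if (!b) = true then refresh v >>= fun _ => f else f)
      Post := by
  refine Spec.bind (spec_refresh hv) fun b w₁ hw₁ hb => ?_
  cases b
  · simp only [Bool.not_false, if_true]
    refine Spec.bind (spec_refresh hv) fun b w₂ hw₂ hb₂ => hf w₂ (hw₁.trans hw₂) ?_
    cases b
    · obtain ⟨h₁, h1, h2⟩ := hb
      obtain ⟨h₂, h3, h4⟩ := hb₂
      exact absorbed_of_head_lt (T.not_isLeaf hv) hw₁ hw₂ h1 h2 h3 h4
    · exact fun d b hb => hb₂ d b (hw₁.le.block_ne hb)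
  · exact hf w₁ hw₁ hb

/-- The block `v.blocks[b]` is represented by a block of the root. -/
def Mem.Reached (m : Mem α) : Addr → ℕ → Prop
  | [], b => m.blocks [] b ≠ none
  | d :: u, b => ∃ j B, m.blocks u j = some B ∧ b ≤ B.endDir d ∧ m.Reached u j

theorem spec_propagate {v : Addr} {l r : LTree (Fin p)} (hv : T.shape.At v (.node l r)) :
    Spec T k w (propagate v) fun _ w' =>
      ∀ d b, w.blocks (d :: v) b ≠ none → w'.Reached (d :: v) b := by
  induction v generalizing w l r with
  | nil =>
    refine spec_refresh_twice hv fun w₁ hw₁ h1 => Spec.pure fun w₂ hw₂ d b hb => ?_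
    obtain ⟨j, B, hB, hb⟩ := h1 d b hb
    exact ⟨j, B, hw₂.le.blocks hB, hb, by simp [Mem.Reached, hw₂.le.blocks hB]⟩
  | cons e u ih =>
    obtain ⟨_, _, hu, -⟩ := hv.parent
    refine spec_refresh_twice hv fun w₁ hw₁ h1 => (ih hu).mono fun _ w₂ hw₂ h2 d b hb => ?_
    obtain ⟨j, B, hB, hb⟩ := h1 d b hb
    exact ⟨j, B, hw₂.le.blocks hB, hb, h2 e j (by simp [hB])⟩

end Procedures

/-! ### Appending an operation to the own leaf -/

section Append

variable {p : ℕ} {α : Type} {T : OrderingTree p} {w : World p α} {k : Fin p} {R : Type}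

variable (T) in
/-- The leaf of `k` has exactly the blocks `0..n`, and its head is up to date. -/
def Own (w : World p α) (k : Fin p) (n : ℕ) : Prop :=
  w.head (T.leaf k) = n + 1 ∧ w.blocks (T.leaf k) (n + 1) = none

/-- Other processes may help to advance this head, but not past a null entry, and only the owner
fills the entries of the leaf. -/
theorem Own.rely {w' : World p α} {n : ℕ} (h : Own T w k n) (hr : Rely T k w w') :
    Own T w' k n := by
  have h1 := hr.le.head (T.leaf k)
  have h2 : w'.blocks (T.leaf k) (n + 1) = none := by rw [hr.leaf]; exact h.2
  refine ⟨?_, h2⟩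
  have h3 : ¬ n + 1 < w'.head (T.leaf k) := fun h4 => hr.inv.ne_none h4 h2
  have := h.1
  omega

/-- `Spec` promises that the own leaf array is unchanged, which fails for code that contains the
write in `append`. Such code is treated with `wp` directly, by this rule and the next. -/
theorem wp_getBlock {v : Addr} {i : ℕ} {B : Block α} {f : Block α → Prog α R}
    {Q : R → World p α → Prop} (hB : w.blocks v i = some B)
    (h : ∀ w', Rely T k w w' → wp T k Q (f B) w') :
    ∀ w', Rely T k w w' → wp T k Q (getBlock v i >>= f) w' := by
  intro w' hw w'' hw'
  have h1 := (hw.trans hw').le.blocks hB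
  simp only [h1]
  exact h w'' (hw.trans hw')

theorem wp_getHead {n : ℕ} {f : ℕ → Prog α R} {Q : R → World p α → Prop} (ho : Own T w k n)
    (h : ∀ w', Rely T k w w' → wp T k Q (f (n + 1)) w') :
    ∀ w', Rely T k w w' → wp T k Q (getHead (T.leaf k) >>= f) w' := by
  intro w' hw w'' hw'
  have h1 := (ho.rely (hw.trans hw')).1
  simp only [h1]
  exact h w'' (hw.trans hw')

theorem Spec.bind_getHead_own {n : ℕ} {f : ℕ → Prog α R} {Post : R → World p α → Prop}
    (ho : Own T w k n) (h : Spec T k w (f (n + 1)) Post) :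
    Spec T k w (getHead (T.leaf k) >>= f) Post :=
  wp_getHead ho h

theorem OrderingTree.leaf_parent (T : OrderingTree p) {d : Bool} {u : Addr} (h : T.leaf k = d :: u) :
    ∃ l r, T.shape.At u (.node l r) := by
  obtain ⟨l, r, h1, -⟩ := (T.at_leaf_iff.2 h).parent
  exact ⟨l, r, h1⟩

theorem wp_append (hp : 2 ≤ p) {n : ℕ} {B B' : Block α} (ho : Own T w k n)
    (hB' : w.blocks (T.leaf k) n = some B') (hstep : LeafStep B' B (w.ops k)[n]?) :
    ∀ w', Rely T k w w' → wp T k (fun _ w'' => Inv T w'' ∧ Le w w'' ∧ w''.ops k = w.ops k ∧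
      Own T w'' k (n + 1) ∧ w''.Reached (T.leaf k) (n + 1)) (append (T.leaf k) B) w' := by
  unfold append
  refine wp_getHead ho fun w₁ hw₁ w₂ hw₂ => ?_
  have hr := hw₁.trans hw₂
  have ho₂ := ho.rely hr
  have hle := Le.setBlock (B := B) ho₂.2
  have hsums : B'.sumEnq ≤ B.sumEnq ∧ B'.sumDeq ≤ B.sumDeq ∧
      B'.sumEnq + B'.sumDeq < B.sumEnq + B.sumDeq := by
    rcases hstep with ⟨x, -, -, h1, h2⟩ | ⟨-, -, h1, h2⟩ <;> omega
  have hinv := hr.inv.setBlock (B := B) (B' := B') ho₂.1.ge ho₂.2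
    { prev := hr.le.blocks hB', pos := by omega, sums := hsums
      ends := fun h => absurd ⟨k, rfl⟩ h, node_sum := fun h => absurd ⟨k, rfl⟩ h
      size := fun h => absurd h (T.leaf_ne_nil hp k)
      leaf := fun j hj => by
        obtain rfl := T.leaf_injective hj
        rw [hr.ops]
        exact hstep }
  refine ⟨_, rfl, ⟨hle, hinv, fun j hj i => ?_, rfl⟩, ?_⟩
  · simp only [Mem.setBlock_blocks]
    rw [if_neg]
    exact fun h => hj (T.leaf_injective h.1)
  set w₃ : World p α := { w₂ with toMem := w₂.setBlock (T.leaf k) (n + 1) B } with hw₃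
  have hblock : w₃.blocks (T.leaf k) (n + 1) = some B := by
    simp [hw₃, Mem.setBlock_blocks]
  have hnone : w₃.blocks (T.leaf k) (n + 1 + 1) = none :=
    hinv.eq_none (by have : w₃.head (T.leaf k) = n + 1 := ho₂.1
                     omega)
  obtain ⟨d, u, hdu⟩ := List.exists_cons_of_ne_nil (T.leaf_ne_nil hp k)
  obtain ⟨l, r, hu⟩ := T.leaf_parent hdu
  -- After the write the process no longer changes the entries of its leaf, so the rules for `Spec`
  -- apply from `w₃` on.
  have main : Spec T k w₃ (do
      advance (T.leaf k) (n + 1)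
      match T.leaf k with
      | [] => .crash
      | _ :: parent => propagate parent) fun _ w' =>
        n + 1 < w'.head (T.leaf k) ∧ w'.Reached (T.leaf k) (n + 1) := by
    refine Spec.bind (spec_advance (by omega) (by simp [hblock]) fun e x hx => ?_)
      fun _ w₄ hw₄ hadv => ?_
    · rw [hdu] at hx
      cases hx
      exact T.not_isLeaf hu
    · have hb₄ := hw₄.le.blocks hblock
      rw [hdu] at hb₄ hadv ⊢
      exact (spec_propagate hu).mono fun _ w₅ hw₅ h5 =>
        ⟨hadv.trans_le (hw₅.le.head _), h5 d _ (by simp [hb₄])⟩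
  refine wp_mono ?_ _ _ (main w₃ (Rely.refl hinv))
  rintro _ w₅ ⟨hw₅, h5, h6⟩
  refine ⟨hw₅.inv, (hr.le.trans hle).trans hw₅.le, hw₅.ops.trans hr.ops, ?_, h6⟩
  have h7 : w₅.blocks (T.leaf k) (n + 1 + 1) = none := by rw [hw₅.leaf]; exact hnone
  -- `advance` has moved the head past `n + 1`; the null entry at `n + 2` stops it there.
  have h8 : ¬ n + 1 + 1 < w₅.head (T.leaf k) := fun h => hw₅.inv.ne_none h h7
  exact ⟨by omega, h7⟩

end Append

/-! ### Operation sequences of blocks and their lengths -/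

section Sequences

variable {p : ℕ} {α : Type} {T : OrderingTree p} {w w' : World p α}

/-- The concatenation of `f (a + 1), …, f b`. -/
def seg {β : Type} (f : ℕ → List β) (a b : ℕ) : List β := (List.Ico (a + 1) (b + 1)).flatMap f

section Seg

variable {β : Type} {f g : ℕ → List β}

theorem seg_append {a b c : ℕ} (h : a ≤ b) (h' : b ≤ c) : seg f a b ++ seg f b c = seg f a c := by
  unfold seg
  rw [← List.flatMap_append, List.Ico.append_consecutive (by omega) (by omega)]

theorem seg_self (a : ℕ) : seg f a a = [] := by simp [seg]

theorem seg_succ (a : ℕ) : seg f a (a + 1) = f (a + 1) := by simp [seg]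

theorem mem_seg {x : β} {a b : ℕ} : x ∈ seg f a b ↔ ∃ j, a < j ∧ j ≤ b ∧ x ∈ f j := by
  simp only [seg, List.mem_flatMap, List.Ico.mem, Nat.lt_succ_iff, Nat.succ_le_iff, and_assoc]

theorem seg_congr {a b : ℕ} (h : ∀ j, a < j → j ≤ b → f j = g j) : seg f a b = seg g a b := by
  unfold seg
  refine List.flatMap_congr fun j hj => ?_
  rw [List.Ico.mem] at hj
  exact h j (by omega) (by omega)

theorem nodup_seg {a b : ℕ} (h : ∀ j, a < j → j ≤ b → (f j).Nodup)
    (h' : ∀ i j x, i ≤ b → j ≤ b → x ∈ f i → x ∈ f j → i = j) : (seg f a b).Nodup := by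
  unfold seg
  rw [List.nodup_flatMap]
  refine ⟨fun j hj => ?_, ?_⟩
  · rw [List.Ico.mem] at hj
    exact h j (by omega) (by omega)
  · refine List.Pairwise.imp_of_mem ?_ (List.Ico.pairwise_lt (a + 1) (b + 1))
    intro i j hi hj hij x hxi hxj
    rw [List.Ico.mem] at hi hj
    exact hij.ne (h' i j x (by omega) (by omega) hxi hxj)

end Seg

/-- The function `sum` counts the operations of the blocks selected by `sel`. -/
structure Counts (T : OrderingTree p) (w : World p α) (sel : Block α → Bool) (sum : Block α → ℤ) :
    Prop where
  leaf : ∀ {k i B B'}, w.blocks (T.leaf k) i = some B → w.blocks (T.leaf k) (i + 1) = some B' →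
    sum B' = sum B + if sel B' then 1 else 0
  node : ∀ {v i B L R}, ¬ T.IsLeaf v → w.blocks v i = some B →
    w.blocks (false :: v) B.endLeft = some L → w.blocks (true :: v) B.endRight = some R →
    sum B = sum L + sum R

theorem Inv.counts_enq (hw : Inv T w) : Counts T w (fun B => B.element.isSome) Block.sumEnq where
  leaf h h' := by
    rcases hw.leaf h h' with ⟨x, h1, -, h2, -⟩ | ⟨h1, -, h2, -⟩ <;> simp [h1, h2]
  node hv hB hL hR := (hw.node_sum hv hB hL hR).1

theorem Inv.counts_deq (hw : Inv T w) : Counts T w (fun B => B.element.isNone) Block.sumDeq where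
  leaf h h' := by
    rcases hw.leaf h h' with ⟨x, h1, -, -, h2⟩ | ⟨h1, -, -, h2⟩ <;> simp [h1, h2]
  node hv hB hL hR := (hw.node_sum hv hB hL hR).2

theorem Mem.endOf_eq {m : Mem α} {v : Addr} {b : ℕ} {B : Block α} (h : m.blocks v b = some B)
    (d : Bool) : m.endOf v b d = B.endDir d := by
  simp [Mem.endOf, h]

theorem Mem.opSeq_node (m : Mem α) (sel : Block α → Bool) (l r : LTree (Fin p)) (v : Addr)
    (b : ℕ) : m.opSeq sel (.node l r) v b =
      seg (m.opSeq sel l (false :: v)) (m.endOf v (b - 1) false) (m.endOf v b false) ++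
      seg (m.opSeq sel r (true :: v)) (m.endOf v (b - 1) true) (m.endOf v b true) := rfl

theorem seg_length (hw : Inv T w) {β : Type} {f : ℕ → List β} {sum : Block α → ℤ} {v : Addr}
    (hf : ∀ i B B', w.blocks v i = some B → w.blocks v (i + 1) = some B' →
      ((f (i + 1)).length : ℤ) = sum B' - sum B) {a c : ℕ} (hac : a ≤ c) {A C : Block α}
    (hA : w.blocks v a = some A) (hC : w.blocks v c = some C) :
    ((seg f a c).length : ℤ) = sum C - sum A := by
  induction c, hac using Nat.le_induction generalizing C with
  | base => simp_all [seg_self]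
  | succ c hac ih =>
    obtain ⟨D, hD⟩ := hw.exists_block (Nat.le_succ c) hC
    rw [← seg_append hac (Nat.le_succ c), seg_succ, List.length_append, Nat.cast_add, ih hD,
      hf c D C hD hC]
    ring

variable {sel : Block α → Bool} {sum : Block α → ℤ}

/-- Induction on the tree: in each child the lengths telescope between the ends of the two blocks,
and the sums at these ends add up to the sums of the blocks themselves. -/
theorem Counts.length_opSeq (hc : Counts T w sel sum) (hw : Inv T w) {t : LTree (Fin p)} {v : Addr}
    (hv : T.shape.At v t) {i : ℕ} {B B' : Block α} (hB : w.blocks v i = some B)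
    (hB' : w.blocks v (i + 1) = some B') :
    ((w.opSeq sel t v (i + 1)).length : ℤ) = sum B' - sum B := by
  induction t generalizing v i B B' with
  | leaf k =>
    obtain rfl := T.at_leaf_iff.1 hv
    rw [hc.leaf hB hB']
    simp only [Mem.opSeq, hB']
    split_ifs <;> simp
  | node l r ihl ihr =>
    have hnl := T.not_isLeaf hv
    rw [Mem.opSeq_node, Nat.add_sub_cancel, List.length_append, Nat.cast_add]
    simp only [Mem.endOf_eq hB, Mem.endOf_eq hB']
    obtain ⟨L, hL⟩ := hw.exists_of_lt (hw.ends_lt hnl hB false)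
    obtain ⟨R, hR⟩ := hw.exists_of_lt (hw.ends_lt hnl hB true)
    obtain ⟨L', hL'⟩ := hw.exists_of_lt (hw.ends_lt hnl hB' false)
    obtain ⟨R', hR'⟩ := hw.exists_of_lt (hw.ends_lt hnl hB' true)
    rw [seg_length hw (fun i C C' h h' => ihl hv.left h h') (hw.ends_mono hnl hB hB' false) hL hL',
      seg_length hw (fun i C C' h h' => ihr hv.right h h') (hw.ends_mono hnl hB hB' true) hR hR',
      hc.node hnl hB hL hR, hc.node hnl hB' hL' hR']
    ring

theorem Counts.length_seg (hc : Counts T w sel sum) (hw : Inv T w) {t : LTree (Fin p)} {v : Addr}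
    (hv : T.shape.At v t) {a c : ℕ} (hac : a ≤ c) {A C : Block α}
    (hA : w.blocks v a = some A) (hC : w.blocks v c = some C) :
    ((seg (w.opSeq sel t v) a c).length : ℤ) = sum C - sum A :=
  seg_length hw (fun _ _ _ h h' => hc.length_opSeq hw hv h h') hac hA hC

theorem Inv.endOf_mono (hw : Inv T w) {v : Addr} (hv : ¬ T.IsLeaf v) {i j : ℕ} (hij : i ≤ j)
    (hj : w.blocks v j ≠ none) (d : Bool) : w.endOf v i d ≤ w.endOf v j d := by
  obtain ⟨B', hB'⟩ := Option.ne_none_iff_exists'.1 hj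
  obtain ⟨B, hB⟩ := hw.exists_block hij hB'
  rw [Mem.endOf_eq hB, Mem.endOf_eq hB']
  exact hw.endDir_mono hv hij hB hB' d

theorem Mem.block_ne_of_endOf {m : Mem α} {v : Addr} {b : ℕ} {d : Bool} (h : 0 < m.endOf v b d) :
    m.blocks v b ≠ none := by
  intro hn
  simp [Mem.endOf, hn] at h

theorem Inv.endOf_lt (hw : Inv T w) {v : Addr} (hv : ¬ T.IsLeaf v) (b : ℕ) (d : Bool) :
    w.endOf v b d < w.head (d :: v) := by
  cases h : w.blocks v b with
  | none => simp only [Mem.endOf, h]; exact hw.head_pos _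
  | some B => rw [Mem.endOf_eq h]; exact hw.ends_lt hv h d

/-- Addresses list the steps upwards, so the address of a node is a suffix of those of its
descendants. This is what separates the operations of two siblings. -/
theorem mem_opSeq_leaf {t : LTree (Fin p)} {v : Addr} (hv : T.shape.At v t) {b : ℕ} {x : OpId p}
    (hx : x ∈ w.opSeq sel t v b) :
    v <:+ T.leaf x.1 ∧ ∃ B, w.blocks (T.leaf x.1) (x.2 + 1) = some B ∧ sel B = true := by
  induction t generalizing v b with
  | leaf k =>
    obtain rfl := T.at_leaf_iff.1 hv
    cases b with
    | zero => simp [Mem.opSeq] at hx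
    | succ n =>
      simp only [Mem.opSeq] at hx
      cases hB : w.blocks (T.leaf k) (n + 1) with
      | none => simp [hB] at hx
      | some B =>
        simp only [hB] at hx
        split_ifs at hx with hs
        · obtain rfl := List.mem_singleton.1 hx
          exact ⟨List.suffix_rfl, B, hB, hs⟩
        · simp at hx
  | node l r ihl ihr =>
    rw [Mem.opSeq_node, List.mem_append, mem_seg, mem_seg] at hx
    rcases hx with ⟨j, -, -, hx⟩ | ⟨j, -, -, hx⟩
    · have := ihl hv.left hx
      exact ⟨(List.suffix_cons _ _).trans this.1, this.2⟩
    · have := ihr hv.right hx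
      exact ⟨(List.suffix_cons _ _).trans this.1, this.2⟩

theorem not_mem_left_right {sel' : Block α → Bool} {l r : LTree (Fin p)} {v : Addr}
    (hv : T.shape.At v (.node l r)) {i j : ℕ} {x : OpId p}
    (hx : x ∈ w.opSeq sel l (false :: v) i) (hx' : x ∈ w.opSeq sel' r (true :: v) j) : False := by
  have h1 := (mem_opSeq_leaf hv.left hx).1
  have h2 := (mem_opSeq_leaf hv.right hx').1
  have := (List.suffix_of_suffix_length_le h1 h2 (by simp)).eq_of_length (by simp)
  simp at this

/-- The ends are monotone, so the subblocks of different blocks form disjoint intervals. Two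
selections are allowed in order to compare the enqueues of one block with the dequeues of another.
-/
theorem opSeq_index_unique {sel' : Block α → Bool} (hw : Inv T w) {t : LTree (Fin p)} {v : Addr}
    (hv : T.shape.At v t) {i j : ℕ} {x : OpId p}
    (hx : x ∈ w.opSeq sel t v i) (hx' : x ∈ w.opSeq sel' t v j) : i = j := by
  induction t generalizing v i j with
  | leaf k =>
    have key : ∀ (s : Block α → Bool) b, x ∈ w.opSeq s (.leaf k) v b → b = x.2 + 1 := by
      intro s b hb
      cases b with
      | zero => simp [Mem.opSeq] at hb
      | succ n =>
        simp only [Mem.opSeq] at hb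
        split at hb
        · split_ifs at hb
          · rw [List.mem_singleton.1 hb]
          · simp at hb
        · simp at hb
    rw [key _ _ hx, key _ _ hx']
  | node l r ihl ihr =>
    have hnl := T.not_isLeaf hv
    have key : ∀ {d : Bool} {i j a : ℕ}, w.endOf v (i - 1) d < a → a ≤ w.endOf v i d →
        w.endOf v (j - 1) d < a → a ≤ w.endOf v j d → i ≤ j := by
      intro d i j a h1 h2 h3 h4
      by_contra hc
      obtain ⟨B, hB⟩ := Option.ne_none_iff_exists'.1
        (Mem.block_ne_of_endOf (m := w.toMem) (v := v) (b := i) (d := d) (by omega))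
      obtain ⟨C, hC⟩ := hw.exists_block (show i - 1 ≤ i by omega) hB
      have := hw.endOf_mono hnl (show j ≤ i - 1 by omega) (by simp [hC]) d
      omega
    rw [Mem.opSeq_node, List.mem_append, mem_seg, mem_seg] at hx hx'
    rcases hx with ⟨a, h1, h2, hx⟩ | ⟨a, h1, h2, hx⟩ <;>
      rcases hx' with ⟨b, h3, h4, hx'⟩ | ⟨b, h3, h4, hx'⟩
    · obtain rfl := ihl hv.left hx hx'
      exact le_antisymm (key h1 h2 h3 h4) (key h3 h4 h1 h2)
    · exact (not_mem_left_right hv hx hx').elim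
    · exact (not_mem_left_right hv hx' hx).elim
    · obtain rfl := ihr hv.right hx hx'
      exact le_antisymm (key h1 h2 h3 h4) (key h3 h4 h1 h2)

theorem nodup_opSeq (hw : Inv T w) {t : LTree (Fin p)} {v : Addr} (hv : T.shape.At v t) (b : ℕ) :
    (w.opSeq sel t v b).Nodup := by
  induction t generalizing v b with
  | leaf k =>
    cases b with
    | zero => simp [Mem.opSeq]
    | succ n =>
      simp only [Mem.opSeq]
      split
      · split_ifs <;> simp
      · simp
  | node l r ihl ihr =>
    rw [Mem.opSeq_node, List.nodup_append]
    refine ⟨nodup_seg (fun j _ _ => ihl hv.left j)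
        fun i j x _ _ hi hj => opSeq_index_unique hw hv.left hi hj,
      nodup_seg (fun j _ _ => ihr hv.right j)
        fun i j x _ _ hi hj => opSeq_index_unique hw hv.right hi hj, ?_⟩
    rintro x hx y hy rfl
    rw [mem_seg] at hx hy
    obtain ⟨i, -, -, hi⟩ := hx
    obtain ⟨j, -, -, hj⟩ := hy
    exact not_mem_left_right hv hi hj

/-- The ends of an existing block lie below the heads of the children, so its whole hierarchy of
subblocks already exists and is final. -/
theorem Le.opSeq_eq (hle : Le w w') (hw : Inv T w) {t : LTree (Fin p)} {v : Addr}
    (hv : T.shape.At v t) {b : ℕ} (hb : w.blocks v b ≠ none) :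
    w'.opSeq sel t v b = w.opSeq sel t v b := by
  induction t generalizing v b with
  | leaf k =>
    cases b with
    | zero => simp [Mem.opSeq]
    | succ n =>
      obtain ⟨B, hB⟩ := Option.ne_none_iff_exists'.1 hb
      simp only [Mem.opSeq, hB, hle.blocks hB]
  | node l r ihl ihr =>
    have hnl := T.not_isLeaf hv
    obtain ⟨B, hB⟩ := Option.ne_none_iff_exists'.1 hb
    obtain ⟨C, hC⟩ := hw.exists_block (show b - 1 ≤ b by omega) hB
    rw [Mem.opSeq_node, Mem.opSeq_node]
    simp only [Mem.endOf_eq hB, Mem.endOf_eq hC, Mem.endOf_eq (hle.blocks hB),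
      Mem.endOf_eq (hle.blocks hC)]
    congr 1
    · exact seg_congr fun j _ hj =>
        ihl hv.left (hw.ne_none (hj.trans_lt (hw.ends_lt hnl hB false)))
    · exact seg_congr fun j _ hj =>
        ihr hv.right (hw.ne_none (hj.trans_lt (hw.ends_lt hnl hB true)))

/-- The block `(d :: u).blocks[b]` is a direct subblock of `u.blocks[s]`. -/
structure Mem.Contains (m : Mem α) (d : Bool) (u : Addr) (b s : ℕ) : Prop where
  pos : 1 ≤ s
  lt : m.endOf u (s - 1) d < b
  le : b ≤ m.endOf u s d

theorem Inv.reached_of_le (hw : Inv T w) {v : Addr} {b c : ℕ} (hbc : b ≤ c) (h : w.Reached v c) :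
    w.Reached v b := by
  cases v with
  | nil =>
    obtain ⟨C, hC⟩ := Option.ne_none_iff_exists'.1 h
    obtain ⟨B, hB⟩ := hw.exists_block hbc hC
    simp [Mem.Reached, hB]
  | cons d u =>
    obtain ⟨j, B, h1, h2, h3⟩ := h
    exact ⟨j, B, h1, hbc.trans h2, h3⟩

/-- Take the least `s` whose end is at least `b`. It is positive because the ends of `blocks[0]` are
0, and it is reached because it is at most the index `j` that witnesses `h`. -/
theorem Inv.exists_contains (hw : Inv T w) {d : Bool} {u : Addr} {b : ℕ} (hb : 1 ≤ b)
    (h : w.Reached (d :: u) b) : ∃ s, w.Contains d u b s ∧ w.Reached u s := by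
  classical
  obtain ⟨j, B, h1, h2, h3⟩ := h
  have hex : ∃ s, b ≤ w.endOf u s d := ⟨j, by rwa [Mem.endOf_eq h1]⟩
  have h0 : 1 ≤ Nat.find hex := by
    by_contra hc
    have hz : Nat.find hex = 0 := by omega
    have := Nat.find_spec hex
    rw [hz, Mem.endOf_eq (hw.zero u)] at this
    cases d <;> simp [Block.endDir] at this <;> omega
  refine ⟨Nat.find hex, ⟨h0, ?_, Nat.find_spec hex⟩, hw.reached_of_le (Nat.find_min' hex ?_) h3⟩
  · exact not_le.1 (Nat.find_min hex (by omega))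
  · rwa [Mem.endOf_eq h1]

theorem Mem.Contains.opSeq {m : Mem α} {d : Bool} {u : Addr} {b s : ℕ}
    (hc : m.Contains d u b s) {l r : LTree (Fin p)} {x : OpId p}
    (hx : x ∈ m.opSeq sel (if d then r else l) (d :: u) b) : x ∈ m.opSeq sel (.node l r) u s := by
  rw [Mem.opSeq_node, List.mem_append, mem_seg, mem_seg]
  cases d
  · exact Or.inl ⟨b, hc.lt, hc.le, hx⟩
  · exact Or.inr ⟨b, hc.lt, hc.le, hx⟩

theorem Inv.mem_root (hw : Inv T w) {t : LTree (Fin p)} {v : Addr} (hv : T.shape.At v t) {b : ℕ}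
    (hb : 1 ≤ b) (h : w.Reached v b) {x : OpId p} (hx : x ∈ w.opSeq sel t v b) :
    ∃ s, 1 ≤ s ∧ w.blocks [] s ≠ none ∧ x ∈ w.opSeq sel T.shape [] s := by
  induction v generalizing t b with
  | nil =>
    obtain rfl := hv.unique .root
    exact ⟨b, hb, h, hx⟩
  | cons d u ih =>
    obtain ⟨l, r, hu, rfl⟩ := hv.parent
    obtain ⟨s, hs, hr⟩ := hw.exists_contains hb h
    exact ih hu hs.pos hr (hs.opSeq hx)

/-! ### The linearization -/

theorem linearization_eq_seg (T : OrderingTree p) (m : Mem α) (n : ℕ) :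
    T.linearization m n = seg (fun b => T.rootEnqs m b ++ T.rootDeqs m b) 0 n := rfl

variable (T) in
/-- The linearization of the operations that have reached the root. -/
noncomputable def lin (w : World p α) : List (OpId p) := T.linearization w.toMem (w.last [])

theorem Inv.disjoint_enq_deq {t : LTree (Fin p)} {v : Addr} (hv : T.shape.At v t)
    {b b' : ℕ} {x : OpId p} (hx : x ∈ w.opSeq (fun B => B.element.isSome) t v b)
    (hx' : x ∈ w.opSeq (fun B => B.element.isNone) t v b') : False := by
  obtain ⟨-, B, hB, h1⟩ := mem_opSeq_leaf hv hx
  obtain ⟨-, C, hC, h2⟩ := mem_opSeq_leaf hv hx'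
  obtain rfl : B = C := by simpa [hB] using hC
  cases h : B.element <;> simp [h] at h1 h2

theorem Inv.nodup_lin (hw : Inv T w) : (lin T w).Nodup := by
  unfold lin
  rw [linearization_eq_seg]
  refine nodup_seg (fun j _ _ => ?_) fun i j x _ _ hi hj => ?_
  · rw [List.nodup_append]
    refine ⟨nodup_opSeq hw .root j, nodup_opSeq hw .root j, ?_⟩
    rintro x hx y hy rfl
    exact Inv.disjoint_enq_deq .root hx hy
  · rw [List.mem_append] at hi hj
    rcases hi with hi | hi <;> rcases hj with hj | hj <;>
      exact opSeq_index_unique hw .root hi hj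

theorem Le.last_le (hle : Le w w') (hw : Inv T w) (hw' : Inv T w') (v : Addr) :
    w.last v ≤ w'.last v :=
  hw'.ne_none_iff.1 (hle.block_ne (hw.ne_none_iff.2 le_rfl))

theorem Le.lin_prefix (hle : Le w w') (hw : Inv T w) (hw' : Inv T w') : lin T w <+: lin T w' := by
  unfold lin
  rw [linearization_eq_seg, linearization_eq_seg,
    ← seg_append (Nat.zero_le _) (hle.last_le hw hw' [])]
  have h : seg (fun b => T.rootEnqs w.toMem b ++ T.rootDeqs w.toMem b) 0 (w.last []) =
      seg (fun b => T.rootEnqs w'.toMem b ++ T.rootDeqs w'.toMem b) 0 (w.last []) := by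
    refine seg_congr fun j _ hj => ?_
    have hj' := hw.ne_none_iff.2 hj
    rw [OrderingTree.rootEnqs, OrderingTree.rootEnqs, OrderingTree.rootDeqs,
      OrderingTree.rootDeqs, hle.opSeq_eq hw .root hj', hle.opSeq_eq hw .root hj']
  rw [h]
  exact List.prefix_append _ _

theorem mem_lin_iff {x : OpId p} : x ∈ lin T w ↔ ∃ b, 0 < b ∧ b ≤ w.last [] ∧
    (x ∈ T.rootEnqs w.toMem b ∨ x ∈ T.rootDeqs w.toMem b) := by
  unfold lin
  rw [linearization_eq_seg, mem_seg]
  simp only [List.mem_append]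

theorem Inv.block_of_mem_lin {x : OpId p} (hx : x ∈ lin T w) :
    ∃ B, w.blocks (T.leaf x.1) (x.2 + 1) = some B := by
  obtain ⟨b, -, -, hx⟩ := mem_lin_iff.1 hx
  rcases hx with hx | hx <;> obtain ⟨-, B, hB, -⟩ := mem_opSeq_leaf .root hx <;> exact ⟨B, hB⟩

theorem Inv.mem_lin_of_reached (hw : Inv T w) {k : Fin p} {n : ℕ} {B : Block α}
    (hB : w.blocks (T.leaf k) (n + 1) = some B) (h : w.Reached (T.leaf k) (n + 1)) :
    (k, n) ∈ lin T w := by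
  rw [mem_lin_iff]
  have hv := T.at_leaf_iff.2 (rfl : T.leaf k = _)
  cases hs : B.element with
  | some a =>
    obtain ⟨s, h1, h2, h3⟩ := hw.mem_root hv (Nat.succ_pos n) h (x := (k, n))
      (sel := fun B => B.element.isSome) (by simp [Mem.opSeq, hB, hs])
    exact ⟨s, h1, hw.ne_none_iff.1 h2, Or.inl h3⟩
  | none =>
    obtain ⟨s, h1, h2, h3⟩ := hw.mem_root hv (Nat.succ_pos n) h (x := (k, n))
      (sel := fun B => B.element.isNone) (by simp [Mem.opSeq, hB, hs])
    exact ⟨s, h1, hw.ne_none_iff.1 h2, Or.inr h3⟩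

end Sequences

/-! ### Ranks, and the searches of a dequeue -/

section Search

variable {p : ℕ} {α : Type} {T : OrderingTree p} {w : World p α} {k : Fin p}

/-- The `i`th entry of the list, counted from 1, is `x`. -/
def Rank {β : Type} (l : List β) (i : ℤ) (x : β) : Prop := ∃ n : ℕ, i = n + 1 ∧ l[n]? = some x

section Rank

variable {β : Type} {l l' : List β} {f : ℕ → List β} {i : ℤ} {x : β}

theorem Rank.pos (h : Rank l i x) : 1 ≤ i := by
  obtain ⟨n, rfl, -⟩ := h
  omega

theorem Rank.le_length (h : Rank l i x) : i ≤ l.length := by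
  obtain ⟨n, rfl, h⟩ := h
  have := (List.getElem?_eq_some_iff.1 h).1
  omega

theorem Rank.mem (h : Rank l i x) : x ∈ l := by
  obtain ⟨n, -, h⟩ := h
  exact List.mem_of_getElem? h

theorem exists_rank (h : 1 ≤ i) (h' : i ≤ l.length) : ∃ x, Rank l i x := by
  obtain ⟨n, rfl⟩ : ∃ n : ℕ, i = n + 1 := ⟨(i - 1).toNat, by omega⟩
  exact ⟨l[n]'(by omega), n, rfl, List.getElem?_eq_getElem _⟩

theorem rank_append_left (h : i ≤ l.length) : Rank (l ++ l') i x ↔ Rank l i x := by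
  constructor <;> rintro ⟨n, rfl, h'⟩ <;> refine ⟨n, rfl, ?_⟩
  · rwa [List.getElem?_append_left (by omega)] at h'
  · rwa [List.getElem?_append_left (by omega)]

theorem rank_append_right (h : 1 ≤ i) : Rank (l ++ l') (i + l.length) x ↔ Rank l' i x := by
  constructor
  · rintro ⟨n, hn, h'⟩
    refine ⟨n - l.length, by omega, ?_⟩
    rwa [List.getElem?_append_right (by omega)] at h'
  · rintro ⟨n, rfl, h'⟩
    refine ⟨n + l.length, by push_cast; ring, ?_⟩
    rwa [List.getElem?_append_right (by omega), Nat.add_sub_cancel]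

theorem rank_seg_iff {a b c : ℕ} (hab : a < b) (hbc : b ≤ c) (h : 1 ≤ i)
    (h' : i ≤ (f b).length) :
    Rank (seg f a c) (i + (seg f a (b - 1)).length) x ↔ Rank (f b) i x := by
  obtain ⟨b, rfl⟩ : ∃ b', b = b' + 1 := ⟨b - 1, by omega⟩
  rw [← seg_append (show a ≤ b by omega) (show b ≤ c by omega),
    ← seg_append (Nat.le_succ b) hbc, seg_succ, Nat.add_sub_cancel, rank_append_right h,
    rank_append_left h']

theorem Rank.seg {a b c : ℕ} (h : Rank (f b) i x) (hab : a < b) (hbc : b ≤ c) :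
    Rank (seg f a c) (i + (seg f a (b - 1)).length) x :=
  (rank_seg_iff hab hbc h.pos h.le_length).2 h

end Rank

/-- Locate a dequeue of a block within the block of the parent that contains it. -/
theorem Counts.rank_parent {sel : Block α → Bool} {sum : Block α → ℤ}
    (hc : Counts T w sel sum) (hw : Inv T w) {d : Bool} {u : Addr}
    {l r : LTree (Fin p)} (hu : T.shape.At u (.node l r)) {b s : ℕ} {i : ℤ} {x : OpId p}
    (hs : w.Contains d u b s)
    (hi : Rank (w.opSeq sel (if d then r else l) (d :: u) b) i x)
    {P C B F L L' : Block α} (hP : w.blocks u (s - 1) = some P) (hC : w.blocks u s = some C)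
    (hB : w.blocks (d :: u) (b - 1) = some B) (hF : w.blocks (d :: u) (P.endDir d) = some F)
    (hL : w.blocks (false :: u) C.endLeft = some L)
    (hL' : w.blocks (false :: u) P.endLeft = some L') :
    Rank (w.opSeq sel (.node l r) u s)
      (i + (sum B - sum F) + if d then sum L - sum L' else 0) x := by
  have hnl := T.not_isLeaf hu
  have hlt := hs.lt
  have hle := hs.le
  rw [Mem.endOf_eq hP] at hlt
  rw [Mem.endOf_eq hC] at hle
  have hmono := hw.endDir_mono hnl (show s - 1 ≤ s by omega) hP hC
  rw [Mem.opSeq_node]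
  simp only [Mem.endOf_eq hP, Mem.endOf_eq hC]
  cases d
  · have h1 := hc.length_seg hw hu.left (show P.endDir false ≤ b - 1 by omega) hF hB
    have h2 := Rank.seg hi hlt hle
    simp only [Bool.false_eq_true, if_false, add_zero, ← h1] at h2 ⊢
    exact (rank_append_left h2.le_length).2 h2
  · have h1 := hc.length_seg hw hu.right (show P.endDir true ≤ b - 1 by omega) hF hB
    have h2 := Rank.seg hi hlt hle
    have h3 := hc.length_seg hw hu.left (hmono false) hL' hL
    simp only [if_true, ← h1, ← h3] at h2 ⊢
    exact (rank_append_right h2.pos).2 h2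

/-- At each level `super` is corrected to the true index `s`, and `Counts.rank_parent` shows that
the program's arithmetic produces the rank in block `s` of the parent. -/
theorem spec_indexDequeue (hw : Inv T w) {t : LTree (Fin p)} {v : Addr} (hv : T.shape.At v t)
    {b : ℕ} (hb : 1 ≤ b) (hr : w.Reached v b) {i : ℤ} {x : OpId p}
    (hi : Rank (w.opSeq (fun B => B.element.isNone) t v b) i x) :
    Spec T k w (indexDequeue v b i) fun r _ => 1 ≤ r.1 ∧ w.blocks [] r.1 ≠ none ∧
      Rank (w.opSeq (fun B => B.element.isNone) T.shape [] r.1) r.2 x := by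
  induction v generalizing t b i with
  | nil =>
    obtain rfl := hv.unique .root
    exact Spec.pure fun _ _ => ⟨hb, hr, hi⟩
  | cons d u ih =>
    obtain ⟨l, r, hu, rfl⟩ := hv.parent
    have hnl := T.not_isLeaf hu
    obtain ⟨s, hs, hrs⟩ := hw.exists_contains hb hr
    have hpos := hs.pos
    have hlt := hs.lt
    have hle := hs.le
    have hbh : b < w.head (d :: u) := hle.trans_lt (hw.endOf_lt hnl s d)
    obtain ⟨C, hC⟩ := Option.ne_none_iff_exists'.1
      (Mem.block_ne_of_endOf (m := w.toMem) (v := u) (b := s) (d := d) (by omega))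
    obtain ⟨P, hP⟩ := hw.exists_block (show s - 1 ≤ s by omega) hC
    rw [Mem.endOf_eq hP] at hlt
    rw [Mem.endOf_eq hC] at hle
    obtain ⟨t, ht⟩ := Option.ne_none_iff_exists'.1 (hw.super_ne_none hb hbh)
    obtain ⟨ht1, ht2, ht3⟩ := hw.super_spec ht
    -- If `t` exceeded `s`, block `s` would be among those that end before `b`.
    have hts : t ≤ s := by
      by_contra hc
      have := ht2 s (by omega) C hC
      omega
    -- Otherwise block `t + 1` precedes block `s`, yet it covers the snapshot for `t + 1` and hence
    -- `b`.
    have hst : s ≤ t + 1 := by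
      by_contra hc
      obtain ⟨D, hD⟩ := hw.exists_block (show t + 1 ≤ s by omega) hC
      have h1 := hw.snap_le hnl (by omega) hD d
      have h2 := hw.le_head (v := u) (i := s) (by simp [hC])
      have h3 := ht3 (by omega)
      have h4 := hw.endDir_mono hnl (show t + 1 ≤ s - 1 by omega) hD hP d
      omega
    obtain ⟨S, hS⟩ := hw.exists_block hts hC
    have hsup : (if b > S.endDir d then t + 1 else t) = s := by
      rcases hts.eq_or_lt with rfl | h1
      · obtain rfl : S = C := by simpa [hS] using hC
        rw [if_neg (by omega)]
      · have : t = s - 1 := by omega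
        subst this
        obtain rfl : S = P := by simpa [hS] using hP
        rw [if_pos (by omega)]
        omega
    obtain ⟨B, hB⟩ := hw.exists_of_lt (v := d :: u) (i := b - 1) (by omega)
    obtain ⟨F, hF⟩ := hw.exists_of_lt (hw.ends_lt hnl hP d)
    obtain ⟨L, hL⟩ := hw.exists_of_lt (hw.ends_lt hnl hC false)
    obtain ⟨L', hL'⟩ := hw.exists_of_lt (hw.ends_lt hnl hP false)
    have hrank := hw.counts_deq.rank_parent hw hu hs hi hP hC hB hF hL hL'
    refine Spec.bind_getSuper (hw.ne_none hbh) ht <| Spec.bind_getBlock hS ?_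
    simp only [hsup]
    refine Spec.bind_getBlock hB <| Spec.bind_getBlock hP <| Spec.bind_getBlock hF ?_
    cases d
    · simp only [Bool.false_eq_true, if_false, add_zero] at hrank ⊢
      exact ih hu hpos hrs hrank
    · simp only [if_true] at hrank ⊢
      exact Spec.bind_getBlock hC <| Spec.bind_getBlock hL <| Spec.bind_getBlock hP <|
        Spec.bind_getBlock hL' <| ih hu hpos hrs hrank

/-- The invariant is that the sum is below `e` at `lo - 1` and at least `e` at `hi`. The two
inequalities at the index found are all that is used later. -/
theorem spec_binarySearch (hw : Inv T w) {v : Addr} {e : ℤ} {lo hi : ℕ} (hlo : 1 ≤ lo)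
    (hlh : lo ≤ hi) {B C : Block α} (hB : w.blocks v hi = some B) (heB : e ≤ B.sumEnq)
    (hC : w.blocks v (lo - 1) = some C) (heC : C.sumEnq < e) :
    Spec T k w (binarySearch v e lo hi) fun r _ => lo ≤ r ∧ r ≤ hi ∧
      ∃ B C, w.blocks v r = some B ∧ e ≤ B.sumEnq ∧ w.blocks v (r - 1) = some C ∧
        C.sumEnq < e := by
  induction hn : hi - lo using Nat.strong_induction_on generalizing lo hi B C with
  | _ n ih =>
    rw [binarySearch]
    split_ifs with h
    · obtain ⟨D, hD⟩ := hw.exists_block (show (lo + hi) / 2 ≤ hi by omega) hB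
      refine Spec.bind_getBlock hD ?_
      split_ifs with he
      · exact (ih _ (by omega) hlo (by omega) hD he hC heC rfl).mono
          fun r _ _ h => ⟨h.1, h.2.1.trans (by omega), h.2.2⟩
      · exact (ih _ (by omega) (by omega) (by omega) hB heB (by simpa using hD) (not_le.1 he)
          rfl).mono fun r _ _ h => ⟨le_trans (by omega) h.1, h.2.1, h.2.2⟩
    · obtain rfl : lo = hi := by omega
      exact Spec.pure fun _ _ => ⟨le_rfl, le_rfl, B, C, hB, heB, hC, heC⟩

/-- The fallback value 1 is a correct left end, because `blocks[0]` has sum 0, which is less than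
`e`. -/
theorem spec_doublingSearch (hw : Inv T w) {e : ℤ} {b j : ℕ} (hb : 1 ≤ b) (he : 1 ≤ e)
    {B : Block α} (hB : w.blocks [] b = some B) :
    Spec T k w (doublingSearch e b j) fun r _ => 1 ≤ r ∧ r ≤ b ∧
      ∃ C, w.blocks [] (r - 1) = some C ∧ C.sumEnq < e := by
  induction hn : b - 2 ^ j using Nat.strong_induction_on generalizing j with
  | _ n ih =>
    have h2 : 0 < 2 ^ j := Nat.two_pow_pos j
    rw [doublingSearch]
    split_ifs with h
    · obtain ⟨D, hD⟩ := hw.exists_block (show b - 2 ^ j ≤ b by omega) hB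
      refine Spec.bind_getBlock hD ?_
      split_ifs with hc
      · exact Spec.pure fun _ _ => ⟨by omega, by omega, D, by simpa using hD, hc⟩
      · exact ih _ (by rw [pow_succ]; omega) rfl
    · exact Spec.pure fun _ _ => ⟨le_rfl, hb, _, hw.zero [], by simp; omega⟩

/-- Find an enqueue of a block among the subblocks of that block. -/
theorem spec_search_child (hw : Inv T w) {t : LTree (Fin p)} {v : Addr} (hv : T.shape.At v t)
    {a c : ℕ} {i : ℤ} {x : OpId p} {A C : Block α} (hac : a ≤ c) (hA : w.blocks v a = some A)
    (hC : w.blocks v c = some C)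
    (hi : Rank (seg (w.opSeq (fun B => B.element.isSome) t v) a c) i x) :
    Spec T k w (binarySearch v (i + A.sumEnq) (a + 1) c) fun b _ =>
      ∃ D, w.blocks v (b - 1) = some D ∧ w.blocks v b ≠ none ∧
        Rank (w.opSeq (fun B => B.element.isSome) t v b) (i - (D.sumEnq - A.sumEnq)) x := by
  have hlen := hw.counts_enq.length_seg hw hv hac hA hC
  have h1 := hi.pos
  have h2 := hi.le_length
  have hne : a ≠ c := by
    rintro rfl
    simp [seg_self] at h2
    omega
  refine (spec_binarySearch hw (by omega) (by omega) hC (by omega) (by simpa using hA)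
    (by omega)).mono ?_
  rintro b - - ⟨hab, hbc, B, D, hB, heB, hD, heD⟩
  refine ⟨D, hD, by simp [hB], ?_⟩
  have h3 := hw.counts_enq.length_seg hw hv (show a ≤ b - 1 by omega) hA hD
  have hb : b - 1 + 1 = b := by omega
  have h4 := hw.counts_enq.length_opSeq hw hv hD (by rw [hb]; exact hB)
  rw [hb] at h4
  rw [← rank_seg_iff (a := a) (c := c) (by omega) hbc (by omega) (by omega), h3]
  simpa using hi

theorem spec_getEnqueue (hw : Inv T w) {t : LTree (Fin p)} {v : Addr} (hv : T.shape.At v t)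
    {b : ℕ} (hb : w.blocks v b ≠ none) {i : ℤ} {x : OpId p}
    (hi : Rank (w.opSeq (fun B => B.element.isSome) t v b) i x) :
    Spec T k w (getEnqueue t v b i) fun r _ =>
      ∃ B, w.blocks (T.leaf x.1) (x.2 + 1) = some B ∧ r = B.element := by
  induction t generalizing v b i with
  | leaf j =>
    obtain rfl := T.at_leaf_iff.1 hv
    obtain ⟨B, hB⟩ := Option.ne_none_iff_exists'.1 hb
    refine Spec.bind_getBlock hB <| Spec.pure fun _ _ => ⟨B, ?_, rfl⟩
    have hx := hi.mem
    cases b with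
    | zero => simp [Mem.opSeq] at hx
    | succ n =>
      simp only [Mem.opSeq, hB] at hx
      split_ifs at hx
      · rw [List.mem_singleton.1 hx]
        exact hB
      · simp at hx
  | node l r ihl ihr =>
    have hnl := T.not_isLeaf hv
    obtain ⟨B, hB⟩ := Option.ne_none_iff_exists'.1 hb
    obtain ⟨P, hP⟩ := hw.exists_block (show b - 1 ≤ b by omega) hB
    obtain ⟨L, hL⟩ := hw.exists_of_lt (hw.ends_lt hnl hB false)
    obtain ⟨L', hL'⟩ := hw.exists_of_lt (hw.ends_lt hnl hP false)
    obtain ⟨R, hR⟩ := hw.exists_of_lt (hw.ends_lt hnl hB true)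
    obtain ⟨R', hR'⟩ := hw.exists_of_lt (hw.ends_lt hnl hP true)
    have hmono := hw.endDir_mono hnl (show b - 1 ≤ b by omega) hP hB
    rw [Mem.opSeq_node] at hi
    simp only [Mem.endOf_eq hB, Mem.endOf_eq hP] at hi
    have hlen := hw.counts_enq.length_seg hw hv.left (hmono false) hL' hL
    refine Spec.bind_getBlock hB <| Spec.bind_getBlock hL <| Spec.bind_getBlock hP <|
      Spec.bind_getBlock hL' <| Spec.bind_getBlock hP <| Spec.bind_getBlock hR' ?_
    split_ifs with hle
    · have hi' := (rank_append_left (by omega)).1 hi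
      refine Spec.bind_getBlock hP <| Spec.bind_getBlock hB <| Spec.bind_const
        (spec_search_child hw hv.left (hmono false) hL' hL hi') ?_
      rintro b' ⟨D, hD, hb', hrank⟩
      exact Spec.bind_getBlock hD <| ihl hv.left hb' hrank
    · have hi' := (rank_append_right (i := i - (L.sumEnq - L'.sumEnq)) (by omega)).1
        (by rwa [hlen, sub_add_cancel])
      refine Spec.bind_getBlock hP <| Spec.bind_getBlock hB <| Spec.bind_const
        (spec_search_child hw hv.right (hmono true) hR' hR hi') ?_
      rintro b' ⟨D, hD, hb', hrank⟩
      exact Spec.bind_getBlock hD <| ihr hv.right hb' hrank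

/-- The queue cannot hold more than was ever enqueued; this makes the rank `e` computed in
`findResponse` positive. -/
theorem Inv.size_bounds (hw : Inv T w) {i : ℕ} {B : Block α} (hB : w.blocks [] i = some B) :
    0 ≤ B.size ∧ B.size ≤ B.sumEnq := by
  induction i generalizing B with
  | zero =>
    rw [hw.zero] at hB
    cases hB
    simp
  | succ i ih =>
    obtain ⟨P, hP⟩ := hw.exists_block (Nat.le_succ i) hB
    have h1 := ih hP
    have h2 := hw.sums hP hB
    have h3 := hw.size hP hB
    omega

/-- If the test for emptiness fails, `e` lies between 1 and the sum of block `b`, so both searches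
succeed and an enqueue of that rank exists in the root. -/
theorem spec_findResponse (hw : Inv T w) {b : ℕ} (hb : 1 ≤ b) {P B : Block α}
    (hP : w.blocks [] (b - 1) = some P) (hB : w.blocks [] b = some B) {i : ℤ} (hi : 1 ≤ i) :
    Spec T k w (findResponse T.shape b i) fun r _ =>
      if P.size + (B.sumEnq - P.sumEnq) < i then r = none
      else ∃ x, Rank (seg (T.rootEnqs w.toMem) 0 b) (i + P.sumEnq - P.size) x ∧
        ∃ C, w.blocks (T.leaf x.1) (x.2 + 1) = some C ∧ r = C.element := by
  refine Spec.bind_getBlock hB <| Spec.bind_getBlock hP <| Spec.bind_getBlock hP ?_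
  split_ifs with hlt
  · exact Spec.pure fun _ _ => rfl
  · have hsize := hw.size_bounds hP
    refine Spec.bind_getBlock hP <| Spec.bind_getBlock hP ?_
    refine Spec.bind_const (spec_doublingSearch hw hb (by omega) hB) ?_
    rintro lo ⟨hlo, hlob, C, hC, heC⟩
    refine Spec.bind_const (spec_binarySearch hw hlo hlob hB (by omega) hC heC) ?_
    rintro be ⟨h1, h2, D, E, hD, heD, hE, heE⟩
    have hb' : be - 1 + 1 = be := by omega
    have h3 := hw.counts_enq.length_opSeq hw .root hE (by rw [hb']; exact hD)
    have h4 := hw.counts_enq.length_seg hw .root (Nat.zero_le (be - 1)) (hw.zero []) hE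
    rw [hb'] at h3
    obtain ⟨x, hx⟩ := exists_rank (l := w.opSeq (fun B => B.element.isSome) T.shape [] be)
      (i := i + P.sumEnq - P.size - E.sumEnq) (by omega) (by omega)
    refine Spec.bind_getBlock hE <| (spec_getEnqueue hw .root (by simp [hD]) hx).mono ?_
    intro r _ _ hr
    refine ⟨x, ?_, hr⟩
    have := Rank.seg hx (show 0 < be by omega) h2
    rw [h4] at this
    change Rank (seg (w.opSeq _ T.shape []) 0 b) _ x
    simpa using this

end Search

/-! ### The sequential queue and the correctness of responses -/

section Sequential

variable {p : ℕ} {α : Type} {T : OrderingTree p} {w w' : World p α}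

/-- The contents of the queue `q` after a sequence of operations. -/
def queueAfter : List α → List (Op α) → List α
  | q, [] => q
  | q, .enq x :: os => queueAfter (q ++ [x]) os
  | q, .deq :: os => queueAfter q.tail os

theorem length_seqResponses (q : List α) (os : List (Op α)) :
    (seqResponses q os).length = os.length := by
  induction os generalizing q with
  | nil => simp [seqResponses]
  | cons o os ih =>
    cases o with
    | enq x => simp [seqResponses, ih]
    | deq => cases q <;> simp [seqResponses, ih]

theorem seqResponses_append (q : List α) (os os' : List (Op α)) :
    seqResponses q (os ++ os') = seqResponses q os ++ seqResponses (queueAfter q os) os' := by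
  induction os generalizing q with
  | nil => simp [seqResponses, queueAfter]
  | cons o os ih =>
    cases o with
    | enq x => simp [seqResponses, queueAfter, ih]
    | deq => cases q <;> simp [seqResponses, queueAfter, ih]

theorem queueAfter_append (q : List α) (os os' : List (Op α)) :
    queueAfter q (os ++ os') = queueAfter (queueAfter q os) os' := by
  induction os generalizing q with
  | nil => simp [queueAfter]
  | cons o os ih => cases o <;> simp [queueAfter, ih]

theorem queueAfter_enqs (q xs : List α) : queueAfter q (xs.map .enq) = q ++ xs := by
  induction xs generalizing q with
  | nil => simp [queueAfter]
  | cons x xs ih => simp [queueAfter, ih]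

theorem queueAfter_deqs (q : List α) (n : ℕ) :
    queueAfter q (List.replicate n .deq) = q.drop n := by
  induction n generalizing q with
  | zero => simp [queueAfter]
  | succ n ih => simp [queueAfter, ih, List.replicate_succ]

theorem seqResponses_deqs (q : List α) {m n : ℕ} (h : m < n) :
    (seqResponses q (List.replicate n .deq))[m]? = some (.value q[m]?) := by
  induction n generalizing q m with
  | zero => omega
  | succ n ih =>
    rw [List.replicate_succ]
    cases q with
    | nil =>
      cases m with
      | zero => simp [seqResponses]
      | succ m => simpa [seqResponses] using ih [] (Nat.lt_of_succ_lt_succ h)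
    | cons x q =>
      cases m with
      | zero => simp [seqResponses]
      | succ m => simpa [seqResponses] using ih q (Nat.lt_of_succ_lt_succ h)

theorem seqResponses_enq (q : List α) (os : List (Op α)) {i : ℕ} {x : α}
    (h : os[i]? = some (.enq x)) : (seqResponses q os)[i]? = some .ack := by
  induction os generalizing q i with
  | nil => simp at h
  | cons o os ih =>
    cases i with
    | zero =>
      obtain rfl : o = .enq x := by simpa using h
      simp [seqResponses]
    | succ i =>
      simp only [List.getElem?_cons_succ] at h
      cases o with
      | enq x => simpa [seqResponses] using ih _ h
      | deq => cases q <;> simpa [seqResponses] using ih _ h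

section FilterMap

variable {β γ : Type} {g : β → Option γ} {l : List β}

theorem length_filterMap_of_total (h : ∀ x ∈ l, g x ≠ none) :
    (l.filterMap g).length = l.length := by
  induction l with
  | nil => rfl
  | cons a l ih =>
    obtain ⟨c, hc⟩ := Option.ne_none_iff_exists'.1 (h a (by simp))
    rw [List.filterMap_cons_some hc, List.length_cons, List.length_cons,
      ih fun x hx => h x (by simp [hx])]

theorem getElem?_filterMap_of_total (h : ∀ x ∈ l, g x ≠ none) (n : ℕ) :
    (l.filterMap g)[n]? = l[n]?.bind g := by
  induction l generalizing n with
  | nil => simp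
  | cons a l ih =>
    obtain ⟨c, hc⟩ := Option.ne_none_iff_exists'.1 (h a (by simp))
    rw [List.filterMap_cons_some hc]
    cases n with
    | zero => simp [hc]
    | succ n => simpa using ih (fun x hx => h x (by simp [hx])) n

theorem getElem?_of_suffix {l' : List β} (h : l <:+ l') (m : ℕ) :
    l[m]? = l'[l'.length - l.length + m]? := by
  obtain ⟨t, rfl⟩ := h
  rw [List.length_append, Nat.add_sub_cancel, List.getElem?_append_right (by omega),
    Nat.add_sub_cancel_left]

end FilterMap

/-- The operation with the given name. -/
def World.opAt (w : World p α) (x : OpId p) : Option (Op α) := (w.ops x.1)[x.2]?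

variable (T) in
/-- The value that the given operation enqueues. -/
def World.val (w : World p α) (x : OpId p) : Option α :=
  (w.blocks (T.leaf x.1) (x.2 + 1)).bind Block.element

theorem Inv.opAt_of_block (hw : Inv T w) {x : OpId p} {B : Block α}
    (hB : w.blocks (T.leaf x.1) (x.2 + 1) = some B) :
    w.opAt x = match B.element with
      | some a => some (.enq a)
      | none => some .deq := by
  obtain ⟨C, hC⟩ := hw.exists_block (Nat.le_succ _) hB
  rcases hw.leaf hC hB with ⟨a, h1, h2, -⟩ | ⟨h1, h2, -⟩ <;> simp [World.opAt, h1, h2]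

theorem Inv.opAt_ne_none (hw : Inv T w) {x : OpId p} (hx : x ∈ lin T w) : w.opAt x ≠ none := by
  obtain ⟨B, hB⟩ := Inv.block_of_mem_lin hx
  rw [hw.opAt_of_block hB]
  cases B.element <;> simp

theorem Inv.opAt_enq (hw : Inv T w) {b : ℕ} {x : OpId p} (hx : x ∈ T.rootEnqs w.toMem b) :
    w.val T x ≠ none ∧ w.opAt x = (w.val T x).map .enq := by
  obtain ⟨-, B, hB, hs⟩ := mem_opSeq_leaf .root hx
  rw [hw.opAt_of_block hB, World.val, hB]
  cases h : B.element <;> simp_all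

theorem Inv.opAt_deq (hw : Inv T w) {b : ℕ} {x : OpId p} (hx : x ∈ T.rootDeqs w.toMem b) :
    w.opAt x = some .deq := by
  obtain ⟨-, B, hB, hs⟩ := mem_opSeq_leaf .root hx
  rw [hw.opAt_of_block hB]
  cases h : B.element <;> simp_all

theorem Inv.filterMap_enqs (hw : Inv T w) (b : ℕ) :
    (T.rootEnqs w.toMem b).filterMap w.opAt =
      ((T.rootEnqs w.toMem b).filterMap (w.val T)).map .enq := by
  rw [List.map_filterMap]
  exact List.filterMap_congr fun x hx => (hw.opAt_enq hx).2

theorem Inv.filterMap_deqs (hw : Inv T w) (b : ℕ) :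
    (T.rootDeqs w.toMem b).filterMap w.opAt =
      List.replicate (T.rootDeqs w.toMem b).length .deq := by
  rw [List.filterMap_congr (g := fun _ => some Op.deq) fun x hx => hw.opAt_deq hx]
  simp [List.map_const']

theorem linearization_succ (m : Mem α) (b : ℕ) : T.linearization m (b + 1) =
    T.linearization m b ++ (T.rootEnqs m (b + 1) ++ T.rootDeqs m (b + 1)) := by
  rw [linearization_eq_seg, linearization_eq_seg, ← seg_append (Nat.zero_le b) (Nat.le_succ b),
    seg_succ]

theorem Inv.length_vals (hw : Inv T w) (b : ℕ) :
    ((T.rootEnqs w.toMem b).filterMap (w.val T)).length = (T.rootEnqs w.toMem b).length :=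
  length_filterMap_of_total fun _ hx => (hw.opAt_enq hx).1

/-- The queue after the operations of the first `b` blocks of the root holds the values of the
last `size` of their enqueues. -/
theorem Inv.queueAfter_linearization (hw : Inv T w) {b : ℕ} {B : Block α}
    (hB : w.blocks [] b = some B) :
    ((queueAfter [] ((T.linearization w.toMem b).filterMap w.opAt)).length : ℤ) = B.size ∧
    queueAfter [] ((T.linearization w.toMem b).filterMap w.opAt) <:+
      (seg (T.rootEnqs w.toMem) 0 b).filterMap (w.val T) := by
  induction b generalizing B with
  | zero =>
    rw [hw.zero] at hB
    cases hB
    simp [linearization_eq_seg, seg_self, queueAfter]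
  | succ b ih =>
    obtain ⟨P, hP⟩ := hw.exists_block (Nat.le_succ b) hB
    obtain ⟨h1, h2⟩ := ih hP
    have h3 := hw.counts_enq.length_opSeq hw .root hP hB
    have h4 := hw.counts_deq.length_opSeq hw .root hP hB
    have h5 := hw.size hP hB
    have h6 := hw.length_vals (b + 1)
    change ((T.rootEnqs w.toMem (b + 1)).length : ℤ) = _ at h3
    change ((T.rootDeqs w.toMem (b + 1)).length : ℤ) = _ at h4
    rw [linearization_succ, List.filterMap_append, List.filterMap_append, queueAfter_append,
      queueAfter_append, hw.filterMap_enqs, hw.filterMap_deqs, queueAfter_enqs, queueAfter_deqs]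
    constructor
    -- The truncated subtraction in the length of `drop` is the maximum with 0 in `size`: the
    -- enqueues of a block precede its dequeues, so excess dequeues just find the queue empty.
    · rw [List.length_drop, List.length_append]
      omega
    · rw [← seg_append (Nat.zero_le b) (Nat.le_succ b), seg_succ, List.filterMap_append]
      refine (List.drop_suffix _ _).trans ?_
      obtain ⟨t, ht⟩ := h2
      exact ⟨t, by rw [← List.append_assoc, ht]⟩

variable (T) in
/-- The response to the operation `x` in the sequential execution of the linearization is `r`. -/
def Answer (w : World p α) (x : OpId p) (r : Resp α) : Prop :=
  ∃ j : ℕ, (lin T w)[j]? = some x ∧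
    (seqResponses [] ((lin T w).filterMap w.opAt))[j]? = some r

theorem Answer.mem {x : OpId p} {r : Resp α} (h : Answer T w x r) : x ∈ lin T w := by
  obtain ⟨j, h, -⟩ := h
  exact List.mem_of_getElem? h

/-- The response to an operation depends only on the operations before it, and the linearization is
extended only at its end. -/
theorem Answer.mono {x : OpId p} {r : Resp α} (h : Answer T w x r) (hle : Le w w') (hw : Inv T w)
    (hw' : Inv T w') : Answer T w' x r := by
  obtain ⟨j, h1, h2⟩ := h
  obtain ⟨t, ht⟩ := hle.lin_prefix hw hw'
  have h3 : (lin T w).filterMap w'.opAt = (lin T w).filterMap w.opAt := by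
    refine List.filterMap_congr fun y hy => ?_
    obtain ⟨o, ho⟩ := Option.ne_none_iff_exists'.1 (hw.opAt_ne_none hy)
    obtain ⟨s, hs⟩ := hle.ops y.1
    rw [ho]
    unfold World.opAt at ho ⊢
    rw [← hs, List.getElem?_append_left (List.getElem?_eq_some_iff.1 ho).1, ho]
  refine ⟨j, ?_, ?_⟩
  · rw [← ht, List.getElem?_append_left (List.getElem?_eq_some_iff.1 h1).1, h1]
  · rw [← ht, List.filterMap_append, h3, seqResponses_append,
      List.getElem?_append_left (List.getElem?_eq_some_iff.1 h2).1, h2]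

theorem Inv.answer_enq (hw : Inv T w) {x : OpId p} {a : α} (hx : x ∈ lin T w)
    (ha : w.opAt x = some (.enq a)) : Answer T w x .ack := by
  obtain ⟨j, hj⟩ := List.mem_iff_getElem?.1 hx
  refine ⟨j, hj, seqResponses_enq (x := a) _ _ ?_⟩
  rw [getElem?_filterMap_of_total fun y hy => hw.opAt_ne_none hy, hj]
  exact ha

/-- Before its own dequeues, block `b` finds the queue `q ++ vs`: the old contents, then its own
enqueued values. Its `i`th dequeue takes the `i`th entry. As `q ++ vs` is a suffix of all values
enqueued up to block `b`, that entry has rank `i + P.sumEnq - P.size` among them, or is missing if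
`i` exceeds the length. -/
theorem Inv.answer_deq (hw : Inv T w) {b : ℕ} (hb : 1 ≤ b) {P B : Block α}
    (hP : w.blocks [] (b - 1) = some P) (hB : w.blocks [] b = some B) {i : ℤ} {x : OpId p}
    (hx : Rank (T.rootDeqs w.toMem b) i x) {r : Option α}
    (hr : if P.size + (B.sumEnq - P.sumEnq) < i then r = none
      else ∃ x, Rank (seg (T.rootEnqs w.toMem) 0 b) (i + P.sumEnq - P.size) x ∧
        ∃ C, w.blocks (T.leaf x.1) (x.2 + 1) = some C ∧ r = C.element) :
    Answer T w x (.value r) := by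
  obtain ⟨b, rfl⟩ : ∃ b', b = b' + 1 := ⟨b - 1, by omega⟩
  rw [Nat.add_sub_cancel] at hP
  obtain ⟨m, rfl, hm⟩ := hx
  obtain ⟨h1, h2⟩ := hw.queueAfter_linearization hP
  have h3 := hw.counts_enq.length_opSeq hw .root hP hB
  have h6 := hw.length_vals (b + 1)
  change ((T.rootEnqs w.toMem (b + 1)).length : ℤ) = _ at h3
  have hlin : lin T w = T.linearization w.toMem b ++ (T.rootEnqs w.toMem (b + 1) ++
      (T.rootDeqs w.toMem (b + 1) ++ seg (fun b => T.rootEnqs w.toMem b ++ T.rootDeqs w.toMem b)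
        (b + 1) (w.last []))) := by
    have hlast : b + 1 ≤ w.last [] := hw.ne_none_iff.1 (by simp [hB])
    rw [lin, linearization_eq_seg, ← seg_append (Nat.zero_le (b + 1)) hlast,
      ← linearization_eq_seg, linearization_succ]
    simp
  have htot : ∀ y ∈ lin T w, w.opAt y ≠ none := fun y hy => hw.opAt_ne_none hy
  have hl1 : ((T.linearization w.toMem b).filterMap w.opAt).length =
      (T.linearization w.toMem b).length :=
    length_filterMap_of_total fun y hy => htot y (by rw [hlin]; simp [hy])
  set q := queueAfter [] ((T.linearization w.toMem b).filterMap w.opAt) with hq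
  set vs := (T.rootEnqs w.toMem (b + 1)).filterMap (w.val T) with hvs
  have hmlt := (List.getElem?_eq_some_iff.1 hm).1
  refine ⟨(T.linearization w.toMem b).length + ((T.rootEnqs w.toMem (b + 1)).length + m), ?_, ?_⟩
  · rw [hlin, List.getElem?_append_right (by omega), Nat.add_sub_cancel_left,
      List.getElem?_append_right (by omega), Nat.add_sub_cancel_left,
      List.getElem?_append_left hmlt, hm]
  · rw [hlin, List.filterMap_append, List.filterMap_append, List.filterMap_append,
      seqResponses_append, seqResponses_append, seqResponses_append, ← hq, hw.filterMap_enqs,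
      hw.filterMap_deqs, queueAfter_enqs, ← hvs,
      List.getElem?_append_right (by rw [length_seqResponses]; omega), length_seqResponses, hl1,
      Nat.add_sub_cancel_left,
      List.getElem?_append_right (by rw [length_seqResponses, List.length_map]; omega),
      length_seqResponses, List.length_map, h6, Nat.add_sub_cancel_left,
      List.getElem?_append_left (by rw [length_seqResponses, List.length_replicate]; exact hmlt),
      seqResponses_deqs _ hmlt]
    congr 2
    split_ifs at hr with hlt
    · rw [hr, List.getElem?_eq_none]
      rw [List.length_append]
      omega
    · obtain ⟨y, ⟨n, hn, hy⟩, C, hC, rfl⟩ := hr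
      have hsuf : q ++ vs <:+ (seg (T.rootEnqs w.toMem) 0 (b + 1)).filterMap (w.val T) := by
        rw [← seg_append (Nat.zero_le b) (Nat.le_succ b), seg_succ, List.filterMap_append]
        obtain ⟨t, ht⟩ := h2
        exact ⟨t, by rw [← List.append_assoc, ht]⟩
      have hval : ∀ z ∈ seg (T.rootEnqs w.toMem) 0 (b + 1), w.val T z ≠ none := fun z hz => by
        obtain ⟨j, -, -, hz⟩ := mem_seg.1 hz
        exact (hw.opAt_enq hz).1
      have hlen := hw.counts_enq.length_seg hw .root (Nat.zero_le (b + 1)) (hw.zero []) hB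
      change ((seg (T.rootEnqs w.toMem) 0 (b + 1)).length : ℤ) = B.sumEnq - 0 at hlen
      have hle := hsuf.length_le
      rw [getElem?_of_suffix hsuf, getElem?_filterMap_of_total hval]
      rw [length_filterMap_of_total hval, List.length_append] at hle ⊢
      -- The length of the whole minus that of the suffix is `P.sumEnq - P.size`, since the enqueues
      -- of the last block cancel; `n` and `m` count from 0.
      have hidx : (seg (T.rootEnqs w.toMem) 0 (b + 1)).length - (q.length + vs.length) + m = n := by
        omega
      rw [hidx, hy]
      simp [World.val, hC]

end Sequential

/-! ### Correctness of the operations and of whole executions -/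

section Main

variable {p : ℕ} {α : Type} {T : OrderingTree p} {w w' : World p α} {k : Fin p}

variable (T) in
/-- The situation when the `n`th operation of `k` has returned `r`. -/
def Done (k : Fin p) (n : ℕ) (r : Resp α) (w : World p α) : Prop :=
  Inv T w ∧ Own T w k (n + 1) ∧ Answer T w (k, n) r

theorem Done.rely {n : ℕ} {r : Resp α} (hr : Rely T k w w') (h : Done T k n r w) :
    Done T k n r w' :=
  ⟨hr.inv, h.2.1.rely hr, h.2.2.mono hr.le h.1 hr.inv⟩

theorem Own.block_ne {n : ℕ} (hw : Inv T w) (h : Own T w k n) : w.blocks (T.leaf k) n ≠ none :=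
  hw.ne_none (by have := h.1; omega)

theorem Own.exists_block {n : ℕ} (hw : Inv T w) (h : Own T w k n) :
    ∃ B, w.blocks (T.leaf k) n = some B :=
  Option.ne_none_iff_exists'.1 (h.block_ne hw)

theorem wp_enqueue (hp : 2 ≤ p) {n : ℕ} {x : α} (hw : Inv T w) (ho : Own T w k n)
    (hop : (w.ops k)[n]? = some (.enq x)) :
    wp T k (Done T k n) (T.program k (.enq x)) w := by
  obtain ⟨B, hB⟩ := ho.exists_block hw
  refine (wp_bind _ _ _).2 ?_
  have hend : ∀ w₁ : World p α, Rely T k w w₁ → wp T k (fun _ w' => Done T k n .ack w')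
      (append (T.leaf k) { element := some x, sumEnq := B.sumEnq + 1, sumDeq := B.sumDeq })
      w₁ := by
    intro w₁ hw₁
    refine wp_mono ?_ _ _ (wp_append hp (ho.rely hw₁) (hw₁.le.blocks hB) ?_ w₁
      (Rely.refl hw₁.inv))
    · rintro _ w₂ ⟨h1, h2, h3, h4, h5⟩
      obtain ⟨C, hC⟩ := h4.exists_block h1
      refine ⟨h1, h4, h1.answer_enq (h1.mem_lin_of_reached hC h5) (a := x) ?_⟩
      rw [World.opAt, h3, hw₁.ops, hop]
    · rw [hw₁.ops]
      exact Or.inl ⟨x, rfl, hop, rfl, rfl⟩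
  refine wp_getHead ho (fun w₁ hw₁ => ?_) w (Rely.refl hw)
  refine wp_getBlock (hw₁.le.blocks hB) (fun w₂ hw₂ => ?_) w₁ (Rely.refl hw₁.inv)
  have hr := hw₁.trans hw₂
  refine wp_getHead (ho.rely hr) (fun w₃ hw₃ => ?_) w₂ (Rely.refl hr.inv)
  have hr := hr.trans hw₃
  refine wp_getBlock (hr.le.blocks hB) (fun w₄ hw₄ => ?_) w₃ (Rely.refl hr.inv)
  exact hend w₄ (hr.trans hw₄)

theorem wp_dequeue (hp : 2 ≤ p) {n : ℕ} (hw : Inv T w) (ho : Own T w k n)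
    (hop : (w.ops k)[n]? = some .deq) :
    wp T k (Done T k n) (T.program k .deq) w := by
  obtain ⟨B, hB⟩ := ho.exists_block hw
  refine (wp_bind _ _ _).2 ?_
  change wp T k (fun r w' => Done T k n (.value r) w') (dequeue T.shape (T.leaf k)) w
  have hafter : ∀ w₁ : World p α, Inv T w₁ → w₁.ops k = w.ops k → Own T w₁ k (n + 1) →
      w₁.Reached (T.leaf k) (n + 1) →
      Spec T k w₁ (do
        let (b, i) ← indexDequeue (T.leaf k) ((← getHead (T.leaf k)) - 1) 1
        findResponse T.shape b i) fun r w' => Done T k n (.value r) w' := by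
    intro w₁ h1 h2 h3 h4
    obtain ⟨C, hC⟩ := h3.exists_block h1
    -- The list of invoked operations identifies the block in the leaf as that of a dequeue.
    have helem : C.element = none := by
      have := h1.opAt_of_block (x := (k, n)) hC
      rw [World.opAt, h2, hop] at this
      cases he : C.element
      · rfl
      · simp [he] at this
    refine Spec.bind_getHead_own h3 ?_
    -- In the leaf the dequeue is the only operation of its block, so it starts with rank 1.
    refine Spec.bind_const (Post := fun r => _) (spec_indexDequeue h1 (T.at_leaf_iff.2 rfl)
      (Nat.succ_pos n) h4 (x := (k, n)) ⟨0, by simp, by simp [Mem.opSeq, hC, helem]⟩) ?_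
    rintro ⟨b, i⟩ ⟨hb, hne, hi⟩
    obtain ⟨D, hD⟩ := Option.ne_none_iff_exists'.1 hne
    obtain ⟨P, hP⟩ := h1.exists_block (show b - 1 ≤ b by omega) hD
    refine (spec_findResponse h1 hb hP hD hi.pos).mono fun r w₂ hw₂ hr => ?_
    exact ⟨hw₂.inv, h3.rely hw₂, (h1.answer_deq hb hP hD hi hr).mono hw₂.le h1 hw₂.inv⟩
  have hend : ∀ w₁ : World p α, Rely T k w w₁ → wp T k (fun r w' => Done T k n (.value r) w')
      (append (T.leaf k) { element := none, sumEnq := B.sumEnq, sumDeq := B.sumDeq + 1 } >>=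
        fun _ => do
          let (b, i) ← indexDequeue (T.leaf k) ((← getHead (T.leaf k)) - 1) 1
          findResponse T.shape b i) w₁ := by
    intro w₁ hw₁
    refine (wp_bind _ _ _).2 <| wp_mono ?_ _ _ (wp_append hp (ho.rely hw₁) (hw₁.le.blocks hB) ?_ w₁
      (Rely.refl hw₁.inv))
    · rintro _ w₂ ⟨h1, h2, h3, h4, h5⟩
      exact wp_mono (fun r w₃ h => h.2) _ _
        (hafter w₂ h1 (h3.trans hw₁.ops) h4 h5 w₂ (Rely.refl h1))
    · rw [hw₁.ops]
      exact Or.inr ⟨rfl, hop, rfl, rfl⟩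
  refine wp_getHead ho (fun w₁ hw₁ => ?_) w (Rely.refl hw)
  refine wp_getBlock (hw₁.le.blocks hB) (fun w₂ hw₂ => ?_) w₁ (Rely.refl hw₁.inv)
  have hr := hw₁.trans hw₂
  refine wp_getHead (ho.rely hr) (fun w₃ hw₃ => ?_) w₂ (Rely.refl hr.inv)
  have hr := hr.trans hw₃
  refine wp_getBlock (hr.le.blocks hB) (fun w₄ hw₄ => ?_) w₃ (Rely.refl hr.inv)
  exact hend w₄ (hr.trans hw₄)

theorem wp_program (hp : 2 ≤ p) {n : ℕ} {o : Op α} (hw : Inv T w) (ho : Own T w k n)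
    (hop : (w.ops k)[n]? = some o) : wp T k (Done T k n) (T.program k o) w := by
  cases o with
  | enq x => exact wp_enqueue hp hw ho hop
  | deq => exact wp_dequeue hp hw ho hop

/-! ### The initial world, and histories extended by an event -/

/-- The initial world. -/
def World.init (p : ℕ) (α : Type) : World p α where
  toMem := Mem.init α
  snap _ _ _ := 0
  ops _ := []

theorem World.init_blocks {v : Addr} {i : ℕ} :
    (World.init p α).blocks v i = if i = 0 then some {} else none := rfl

theorem World.init_eq {v : Addr} {i : ℕ} {B : Block α} :
    (World.init p α).blocks v i = some B ↔ i = 0 ∧ B = {} := by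
  rw [World.init_blocks]
  split_ifs with h <;> simp [h, eq_comm]

theorem Inv.init (T : OrderingTree p) : Inv T (World.init p α) where
  head_pos _ := le_rfl
  eq_none {v i} h := by
    rw [World.init_blocks, if_neg (Nat.ne_of_gt ((Nat.zero_le _).trans_lt h))]
  ne_none {v i} h := by
    have : i = 0 := Nat.lt_one_iff.1 h
    simp [World.init_blocks, this]
  zero _ := rfl
  sums _ h := by simp [World.init_eq] at h
  ends_mono _ _ h := by simp [World.init_eq] at h
  ends_lt _ h d := by
    obtain ⟨-, rfl⟩ := World.init_eq.1 h
    cases d <;> exact Nat.zero_lt_one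
  node_sum _ h hL hR := by
    obtain ⟨-, rfl⟩ := World.init_eq.1 h
    obtain ⟨-, rfl⟩ := World.init_eq.1 hL
    obtain ⟨-, rfl⟩ := World.init_eq.1 hR
    simp
  size _ h := by simp [World.init_eq] at h
  leaf _ h := by simp [World.init_eq] at h
  super_ne_none h h' := absurd (show _ < 1 from h') (by omega)
  super_block h := absurd rfl h
  super_spec h := by cases h
  snap_le _ _ _ _ := Nat.zero_le _
  snap_block _ _ := Option.some_ne_none _

theorem Le.setOps {ops : Fin p → List (Op α)} (h : ∀ k, w.ops k <+: ops k) :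
    Le w { w with ops := ops } :=
  { Le.refl w with ops := h }

theorem Inv.setOps (hw : Inv T w) {ops : Fin p → List (Op α)} (h : ∀ k, w.ops k <+: ops k) :
    Inv T { w with ops := ops } :=
  { hw with
    leaf := fun {k i B B'} hB hB' => by
      have key : ∀ {o}, (w.ops k)[i]? = some o → (ops k)[i]? = some o := by
        intro o ho
        obtain ⟨t, ht⟩ := h k
        rw [← ht, List.getElem?_append_left (List.getElem?_eq_some_iff.1 ho).1, ho]
      rcases hw.leaf hB hB' with ⟨x, h1, h2, h3⟩ | ⟨h1, h2, h3⟩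
      · exact Or.inl ⟨x, h1, key h2, h3⟩
      · exact Or.inr ⟨h1, key h2, h3⟩ }

theorem invocations_append_inv (H : List (Event p α)) (k j : Fin p) (o : Op α) :
    invocations (H ++ [.inv k o]) j = invocations H j ++ if k = j then [o] else [] := by
  simp only [invocations, List.filterMap_append]
  split_ifs with h <;> simp [h]

theorem invocations_append_res (H : List (Event p α)) (k j : Fin p) (r : Resp α) :
    invocations (H ++ [.res k r]) j = invocations H j := by
  simp [invocations]

theorem responses_append_inv (H : List (Event p α)) (k j : Fin p) (o : Op α) :
    responses (H ++ [.inv k o]) j = responses H j := by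
  simp [responses]

theorem responses_append_res (H : List (Event p α)) (k j : Fin p) (r : Resp α) :
    responses (H ++ [.res k r]) j = responses H j ++ if k = j then [r] else [] := by
  simp only [responses, List.filterMap_append]
  split_ifs with h <;> simp [h]

/-! ### The invariant of executions -/

/-- What holds for a process with the remaining program `P`. -/
def ProcOK (T : OrderingTree p) (H : List (Event p α)) (w : World p α) (k : Fin p) :
    Option (Prog α (Resp α)) → Prop
  | none => (invocations H k).length = (responses H k).length ∧
      Own T w k (responses H k).length
  | some P => (invocations H k).length = (responses H k).length + 1 ∧
      wp T k (Done T k (responses H k).length) P w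

theorem ProcOK.rely {H H' : List (Event p α)} {P : Option (Prog α (Resp α))}
    (h : ProcOK T H w k P) (hr : Rely T k w w') (hi : invocations H' k = invocations H k)
    (hr' : responses H' k = responses H k) : ProcOK T H' w' k P := by
  cases P with
  | none => exact ⟨by rw [hi, hr']; exact h.1, by rw [hr']; exact h.2.rely hr⟩
  | some P =>
    exact ⟨by rw [hi, hr']; exact h.1, by
      rw [hr']; exact wp_rely (fun _ _ _ hr hd => hd.rely hr) hr h.2⟩

/-- The operations that terminate in `H` are in `L`, and those in `L` are invoked in `H`. -/
def Between (H : List (Event p α)) (L : List (OpId p)) : Prop :=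
  (∀ a, response H a ≠ none → a ∈ L) ∧ ∀ a ∈ L, invocation H a ≠ none

/-- The invariant of executions. -/
structure Good (T : OrderingTree p) (H : List (Event p α)) (c : Config p α) (w : World p α) :
    Prop where
  mem : w.toMem = c.mem
  inv : Inv T w
  ops : w.ops = invocations H
  proc : ∀ k, ProcOK T H w k (c.proc k)
  answer : ∀ a r, response H a = some r → Answer T w a r
  -- Keeps the past available for the real-time order: for each prefix of the history, the
  -- linearization of that time is a prefix of the present one.
  earlier : ∀ H₁ H₂, H = H₁ ++ H₂ → ∃ L, L <+: lin T w ∧ Between H₁ L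

theorem Inv.between (hw : Inv T w) {H : List (Event p α)} (hops : w.ops = invocations H)
    (h : ∀ a r, response H a = some r → Answer T w a r) : Between H (lin T w) := by
  refine ⟨fun a ha => ?_, fun a ha => ?_⟩
  · obtain ⟨r, hr⟩ := Option.ne_none_iff_exists'.1 ha
    exact (h a r hr).mem
  · have := hw.opAt_ne_none ha
    rwa [World.opAt, hops] at this

/-- A prefix of the longer history is either all of it, witnessed by the present linearization, or a
prefix of the old history. -/
theorem earlier_append {H : List (Event p α)} {e : Event p α}
    (h : ∀ H₁ H₂, H = H₁ ++ H₂ → ∃ L, L <+: lin T w ∧ Between H₁ L)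
    (hl : lin T w <+: lin T w') (hb : Between (H ++ [e]) (lin T w')) (H₁ H₂ : List (Event p α))
    (hH : H ++ [e] = H₁ ++ H₂) : ∃ L, L <+: lin T w' ∧ Between H₁ L := by
  rcases List.eq_nil_or_concat H₂ with rfl | ⟨H₃, e', rfl⟩
  · rw [List.append_nil] at hH
    exact ⟨_, List.prefix_rfl, hH ▸ hb⟩
  · rw [List.concat_eq_append, ← List.append_assoc] at hH
    obtain ⟨L, h1, h2⟩ := h H₁ H₃ (List.append_inj_left' hH rfl)
    exact ⟨L, h1.trans hl, h2⟩

theorem Good.init (T : OrderingTree p) :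
    Good T [] (⟨Mem.init α, fun _ => none⟩ : Config p α) (World.init p α) where
  mem := rfl
  inv := Inv.init T
  ops := rfl
  proc k := ⟨rfl, rfl, rfl⟩
  answer a r h := by simp [response, responses] at h
  earlier H₁ H₂ h := by
    obtain ⟨rfl, rfl⟩ := List.append_eq_nil_iff.1 h.symm
    exact ⟨[], List.nil_prefix, fun a ha => absurd rfl ha, fun a ha => absurd ha (by simp)⟩

theorem Good.invoke (hp : 2 ≤ p) {H : List (Event p α)} {c : Config p α} (h : Good T H c w)
    (k : Fin p) (o : Op α) (hk : c.proc k = none) :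
    Good T (H ++ [.inv k o]) ⟨c.mem, Function.update c.proc k (some (T.program k o))⟩
      { w with ops := invocations (H ++ [.inv k o]) } := by
  have hpre : ∀ j, w.ops j <+: invocations (H ++ [.inv k o]) j := fun j => by
    rw [h.ops, invocations_append_inv]
    exact List.prefix_append _ _
  have hle := Le.setOps hpre
  have hinv := h.inv.setOps hpre
  have hans : ∀ a r, response (H ++ [.inv k o]) a = some r →
      Answer T { w with ops := invocations (H ++ [.inv k o]) } a r := by
    intro a r ha
    rw [response, responses_append_inv] at ha
    exact (h.answer a r ha).mono hle h.inv hinv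
  refine ⟨h.mem, hinv, rfl, fun j => ?_, hans, earlier_append h.earlier
    (hle.lin_prefix h.inv hinv) (hinv.between rfl hans)⟩
  have hj := h.proc j
  by_cases hjk : j = k
  · subst hjk
    rw [hk] at hj
    simp only [Function.update_self]
    refine ⟨?_, ?_⟩
    · rw [responses_append_inv, invocations_append_inv, if_pos rfl, List.length_append, hj.1]
      rfl
    · rw [responses_append_inv]
      refine wp_program hp hinv hj.2 ?_
      simp only [invocations_append_inv, if_true]
      rw [List.getElem?_append_right hj.1.le, hj.1, Nat.sub_self]
      rfl
  · simp only [Function.update_of_ne hjk]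
    have hi : invocations (H ++ [.inv k o]) j = invocations H j := by
      rw [invocations_append_inv, if_neg (Ne.symm hjk), List.append_nil]
    -- For the other processes an invocation is harmless interference: the memory is unchanged and
    -- only the operations of `k` are extended.
    exact hj.rely ⟨hle, hinv, fun _ => rfl, by rw [h.ops]; exact hi⟩ hi
      (responses_append_inv _ _ _ _)

theorem Good.step {H : List (Event p α)} {c : Config p α} (h : Good T H c w) (k : Fin p)
    {P P' : Prog α (Resp α)} {m : Mem α} (hk : c.proc k = some P)
    (hs : P.step c.mem = some (m, P')) :
    ∃ w', Good T H ⟨m, Function.update c.proc k (some P')⟩ w' := by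
  have hkP := h.proc k
  rw [hk] at hkP
  rw [← h.mem] at hs
  obtain ⟨w', h1, h2, h3⟩ := wp_step h.inv hkP.2 hs
  refine ⟨w', h1, h2.inv, h2.ops.trans h.ops, fun j => ?_,
    fun a r ha => (h.answer a r ha).mono h2.le h.inv h2.inv, fun H₁ H₂ hH => ?_⟩
  · by_cases hjk : j = k
    · subst hjk
      simp only [Function.update_self]
      exact ⟨hkP.1, h3⟩
    · simp only [Function.update_of_ne hjk]
      exact (h.proc j).rely (h2.rely hjk) rfl rfl
  · obtain ⟨L, h4, h5⟩ := h.earlier H₁ H₂ hH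
    exact ⟨L, h4.trans (h2.le.lin_prefix h.inv h2.inv), h5⟩

theorem Good.respond {H : List (Event p α)} {c : Config p α} (h : Good T H c w) (k : Fin p)
    (r : Resp α) (hk : c.proc k = some (.ret r)) :
    Good T (H ++ [.res k r]) ⟨c.mem, Function.update c.proc k none⟩ w := by
  have hkP := h.proc k
  rw [hk] at hkP
  have hops : w.ops = invocations (H ++ [.res k r]) := by
    rw [h.ops]
    exact funext fun j => (invocations_append_res _ _ _ _).symm
  have hans : ∀ a s, response (H ++ [.res k r]) a = some s → Answer T w a s := by
    rintro ⟨j, n⟩ s ha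
    simp only [response, responses_append_res] at ha
    rcases lt_or_ge n (responses H j).length with hn | hn
    · rw [List.getElem?_append_left hn] at ha
      exact h.answer (j, n) s ha
    · rw [List.getElem?_append_right hn] at ha
      split_ifs at ha with hkj
      · subst hkj
        have hlt := (List.getElem?_eq_some_iff.1 ha).1
        have hn' : n = (responses H k).length := by simp at hlt; omega
        subst hn'
        obtain rfl : r = s := by simpa using ha
        exact hkP.2.2.2
      · simp at ha
  refine ⟨h.mem, h.inv, hops, fun j => ?_, hans,
    earlier_append h.earlier List.prefix_rfl (h.inv.between hops hans)⟩
  by_cases hjk : j = k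
  · subst hjk
    simp only [Function.update_self]
    have hlen : (responses (H ++ [.res j r]) j).length = (responses H j).length + 1 := by
      rw [responses_append_res, if_pos rfl, List.length_append]
      rfl
    exact ⟨by rw [hlen, invocations_append_res, hkP.1], by rw [hlen]; exact hkP.2.2.1⟩
  · simp only [Function.update_of_ne hjk]
    refine (h.proc j).rely (Rely.refl h.inv) (invocations_append_res _ _ _ _) ?_
    rw [responses_append_res, if_neg (Ne.symm hjk), List.append_nil]

theorem Execution.good (hp : 2 ≤ p) {H : List (Event p α)} {c : Config p α}
    (h : Execution T H c) : ∃ w, Good T H c w := by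
  induction h with
  | init => exact ⟨_, Good.init T⟩
  | invoke k o _ hk ih =>
    obtain ⟨w, hw⟩ := ih
    exact ⟨_, hw.invoke hp k o hk⟩
  | step k _ hk hs ih =>
    obtain ⟨w, hw⟩ := ih
    exact hw.step k hk hs
  | respond k r _ hk ih =>
    obtain ⟨w, hw⟩ := ih
    exact ⟨w, hw.respond k r hk⟩

theorem Good.isLinearization {H : List (Event p α)} {c : Config p α} (h : Good T H c w) :
    IsLinearization H (lin T w) := by
  have hb := h.inv.between h.ops h.answer
  have hnd := h.inv.nodup_lin
  have hop : w.opAt = invocation H := by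
    funext a
    rw [World.opAt, h.ops]
    rfl
  refine ⟨hnd, hb.2, hb.1, ?_, fun i a r hi hr => ?_⟩
  · rw [List.pairwise_iff_getElem]
    rintro i j hi hj hij ⟨H₁, H₂, hH, h1, h2⟩
    -- The operation at position `j` has terminated in `H₁` and so lies in the prefix `L`. Then so
    -- does the one at the smaller position `i`, which must therefore have been invoked in `H₁`, a
    -- contradiction.
    obtain ⟨L, hL, hb₁⟩ := h.earlier H₁ H₂ hH
    obtain ⟨n, hn, hn'⟩ := List.mem_iff_getElem.1 (hb₁.1 _ h1)
    have hnj : n = j := by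
      rw [hL.getElem hn] at hn'
      exact (hnd.getElem_inj_iff).1 hn'
    refine hb₁.2 _ ?_ h2
    rw [← hL.getElem (show i < L.length by omega)]
    exact List.getElem_mem _
  · obtain ⟨j, h1, h2⟩ := h.answer a r hr
    obtain ⟨hi', hi⟩ := List.getElem?_eq_some_iff.1 hi
    obtain ⟨hj', hj⟩ := List.getElem?_eq_some_iff.1 h1
    obtain rfl : i = j := (hnd.getElem_inj_iff).1 (hi.trans hj.symm)
    rwa [← hop]

theorem Good.proc_ne_crash {H : List (Event p α)} {c : Config p α} (h : Good T H c w)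
    (k : Fin p) : c.proc k ≠ some .crash := by
  intro hk
  have := h.proc k
  rw [hk] at this
  exact this.2

end Main

end OrderingQueue

open OrderingQueue
theorem mainTheorem1 {p : ℕ} (hp : 2 ≤ p) (T : OrderingTree p) {α : Type}
    (H : List (Event p α)) (c : Config p α) (hexec : Execution T H c) :
    (∀ k, c.proc k ≠ some Prog.crash) ∧
    (∃ n, (∀ i, c.mem.blocks [] i ≠ none ↔ i ≤ n) ∧
      IsLinearization H (T.linearization c.mem n)) ∧
    Linearizable H := by
  obtain ⟨w, hw⟩ := hexec.good hp
  refine ⟨hw.proc_ne_crash, ⟨w.last [], fun i => ?_, ?_⟩, _, hw.isLinearization⟩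
  · rw [← hw.mem]
    exact hw.inv.ne_none_iff
  · rw [← hw.mem]
    exact hw.isLinearization
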